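/- Let $z$ be a local coordinate near a point $z_0$ of a smooth complex curve, and let $x(z),y(z)$ be functions holomorphic near $z_0$ with $x'(z_0)\neq 0$, $y'(z_0)\ne0$. Fix near $z_0$ a holomorphic branch $r$ of $\sqrt{x'y'}$. A function $f$ (or $f^\vee$) below is a formal power series $\sum_{n\ge0}\hbar^{n/2}f_n(z)$ in $\sqrt\hbar$ whose coefficients are germs of holomorphic functions at $z_0$ (a series in $\hbar$ is the case $f_n=0$ for odd $n$). Formal integrals. Let $S(\chi)$ be holomorphic near $\chi=z$ with $S(z)=S'(z)=0$, $S''(z)\ne0$, and let $s$ be a chosen square root of $-S''(z)$. Then $$\frac1{\sqrt{2\pi\hbar}}\int g(\chi)\,e^{S(\chi)/\hbar}\,d\chi$$ denotes its formal asymptotic expansion around $\chi=z$: substitute $\chi=z+\sqrt\hbar\,\xi$, expand $$g(z+\sqrt\hbar\,\xi)\,\exp\Bigl(\sum_{k\ge3}\hbar^{\frac k2-1}S^{(k)}(z)\tfrac{\xi^k}{k!}\Bigr)$$ as a power series in $\sqrt\hbar$ with coefficients polynomial in $\xi$, and integrate it coefficientwise against $e^{S''(z)\xi^2/2}$ by the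 rule $$\frac1{\sqrt{2\pi}}\int\xi^k e^{-s^2\xi^2/2}\,d\xi:=\begin{cases}0,&k \text{ odd},\\ (k-1)!!\,s^{-(k+1)},&k\text{ even},\end{cases}\qquad (-1)!!=1.$$ Consider the transforms $$(Tf^\vee)(z)=\frac{\mathrm i}{\sqrt{2\pi\hbar}}\int f^\vee(\chi)\,y'(\chi)\,e^{\frac1\hbar\left(x(z)(y(z)-y(\chi))+\int_z^\chi x\,dy\right)}d\chi,$$ $$(T^\vee f)(z)=\frac{1}{\sqrt{2\pi\hbar}}\int f(\chi)\,x'(\chi)\,e^{-\frac1\hbar\left(y(z)(x(z)-x(\chi))+\int_z^\chi y\,dx\right)}d\chi,$$ where the square root of $-S''(z)$ is $s=\mathrm i\,r(z)$ in the first one (here $S''(z)=x'(z)y'(z)$) and $s=r(z)$ in the second one (here $S''(z)=-x'(z)y'(z)$). Then $T$ and $T^\vee$ send power series in $\sqrt\hbar$ with holomorphic coefficients near $z_0$ to such series, they send series in $\hbar$ to series in $\hbar$, and they are inverse to each other: $T^\vee Tf^\vee=f^\vee$ for every $f^\vee$ and $TT^\vee f=f$ for every $f$, as germs at $z_0$ in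 each order of $\sqrt\hbar$. -/

import Mathlib

open scoped Polynomial PowerSeries Topology Nat

/-!
Formal Gaussian integrals.  Throughout, the formal variable of all power series is `√ħ`.
-/

namespace FormalGauss

/-- The value assigned to `(1/√(2π)) ∫ ξ^k e^{-a ξ²/2} dξ`: it is `0` for odd `k` and
`(k-1)!! a^{-(k+1)/2}` for even `k`, where `s` is the chosen square root of `a`
(and `(-1)!! = 1`, in agreement with `(0 - 1)‼ = 0‼ = 1` in `ℕ`). -/
noncomputable def moment (s : ℂ) (k : ℕ) : ℂ :=
  if Even k then ((k - 1)‼ : ℂ) * (s ^ (k + 1))⁻¹ else 0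

/-- `(1/√(2π)) ∫ P(ξ) e^{-a ξ²/2} dξ` for a polynomial `P`, where `s² = a`. -/
noncomputable def polyIntegral (s : ℂ) (P : ℂ[X]) : ℂ :=
  P.sum fun k c => c * moment s k

/-- `(1/√(2π)) ∫ P(ξ) e^{-a ξ²/2} dξ` for a power series `P` in `√ħ` with coefficients
polynomial in `ξ`, where `s² = a`; computed coefficientwise. -/
noncomputable def integral (s : ℂ) (P : ℂ[X]⟦X⟧) : ℂ⟦X⟧ :=
  PowerSeries.mk fun n => polyIntegral s (PowerSeries.coeff n P)

/-- The expansion of `g(z + √ħ ξ)`, where `g = ∑ₘ ħ^{m/2} gₘ` is a power series in `√ħ`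
whose coefficients are functions: the coefficient of `ħ^{n/2}` is
`∑_{k + m = n} gₘ^{(k)}(z) ξ^k / k!`. -/
noncomputable def shift (g : ℕ → ℂ → ℂ) (z : ℂ) : ℂ[X]⟦X⟧ :=
  PowerSeries.mk fun n => ∑ p ∈ Finset.HasAntidiagonal.antidiagonal n,
    Polynomial.C (iteratedDeriv p.1 (g p.2) z / (p.1 ! : ℂ)) * Polynomial.X ^ p.1

/-- The terms of order at least three of the expansion of `S(z + √ħ ξ) / ħ`, that is
`∑_{k ≥ 3} ħ^{k/2 - 1} S^{(k)}(z) ξ^k / k!`, written with `k = m + 2`. -/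
noncomputable def higherTerms (S : ℂ → ℂ) (z : ℂ) : ℂ[X]⟦X⟧ :=
  PowerSeries.mk fun m =>
    if m = 0 then 0
    else Polynomial.C (iteratedDeriv (m + 2) S z / ((m + 2)! : ℂ)) * Polynomial.X ^ (m + 2)

/-- The asymptotic expansion in `√ħ` of `(1/√(2πħ)) ∫ g(χ) e^{S(χ)/ħ} dχ` around the critical
point `χ = z`, where `S(z) = S'(z) = 0` and `s` is the chosen square root of `-S''(z)`.
The substitution `χ = z + √ħ ξ` makes it the formal Gaussian integral
`(1/√(2π)) ∫ g(z + √ħ ξ) exp(∑_{k ≥ 3} ħ^{k/2 - 1} S^{(k)}(z) ξ^k / k!) e^{S''(z) ξ²/2} dξ`. -/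
noncomputable def saddleExpansion (S : ℂ → ℂ) (g : ℕ → ℂ → ℂ) (z s : ℂ) : ℂ⟦X⟧ :=
  integral s (shift g z * (PowerSeries.exp ℂ[X]).subst (higherTerms S z))

/-- The function `x(z)(y(z) - y(χ)) + ∫_z^χ x dy` of `χ`, the integral being taken along the
segment from `z` to `χ`. As a function of `χ` it vanishes together with its first derivative
at `χ = z`, and its second derivative there is `x'(z) y'(z)`. -/
noncomputable def phase (x y : ℂ → ℂ) (z χ : ℂ) : ℂ :=
  x z * (y z - y χ) +
    ∫ t in (0 : ℝ)..1, x (z + t * (χ - z)) * deriv y (z + t * (χ - z)) * (χ - z)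

/-- The transform
`f(z) = (i/√(2πħ)) ∫ f^∨(χ) y'(χ) exp((x(z)(y(z) - y(χ)) + ∫_z^χ x dy)/ħ) dχ`;
`r` is a branch of `√(x'y')` and the square root of `-x'y'` in the Gaussian integral is `i r`.
Both `fv` and the result are series in `√ħ`, given by the sequence of their coefficients. -/
noncomputable def ofDual (x y r : ℂ → ℂ) (fv : ℕ → ℂ → ℂ) : ℕ → ℂ → ℂ := fun n z =>
  Complex.I * PowerSeries.coeff n
    (saddleExpansion (phase x y z) (fun m χ => fv m χ * deriv y χ) z (Complex.I * r z))

/-- The transform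
`f^∨(z) = (1/√(2πħ)) ∫ f(χ) x'(χ) exp(-(y(z)(x(z) - x(χ)) + ∫_z^χ y dx)/ħ) dχ`;
`r` is a branch of `√(x'y')`, and it is the square root used in the Gaussian integral. -/
noncomputable def toDual (x y r : ℂ → ℂ) (f : ℕ → ℂ → ℂ) : ℕ → ℂ → ℂ := fun n z =>
  PowerSeries.coeff n
    (saddleExpansion (fun χ => -phase y x z χ) (fun m χ => f m χ * deriv x χ) z (r z))

end FormalGauss

/-! Put ħ = X². Up to the prefactor `i`, both transforms are instances of one operator: the formal
integral of F(χ) q'(χ) e^{S/ħ}, where ∂S/∂χ = (p(χ) - p(z)) q'(χ) and S vanishes at χ = z. Call it U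
for (p, q) = (x, y), which gives T, and V for (-q, p) = (-y, x), which gives T^∨. Although defined
by moments, the formal Gaussian integral obeys the usual rules of calculus, and these yield three
operator identities: integration by parts, U(pF) - pU(F) = -ħ U(F'/q') (`saddleOp_parts`);
differentiation in z, U(qF) - qU(F) = -ħ (UF)'/p' (`saddleOp_mul_sub`); scaling in ħ, which
expresses 2ħ∂_ħ through multiplication by S (`saddleOp_euler`).

The second identity for U and the first for V cancel, so VU commutes with multiplication by q. Since
q' is invertible, q is a local coordinate; VU is also √ħ-linear, hence it is multiplication by a =
VU(1) (`eq_mul_of_commute`). Adding the scaling identities of U and V gives ħ∂_ħ a = 0, so a equals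
its leading coefficient τσp'q', where σ and τ are the inverse square roots used in U and V. No
higher order is ever computed (`saddleOp_saddleOp`). With the branches ir and r and the prefactor i,
this constant becomes 1.

The calculus is done over any ℂ-algebra with a derivation, then specialised to Taylor series at z₀.
It applies to the actual transforms because their coefficients at a variable point w are polynomial
expressions in derivatives at w and in 1/r(w) (`coeff_saddleExpansion`,
`hasTaylorAt_coeff_saddleExpansion`), and because a germ is determined by its Taylor series. -/

namespace FormalGauss

open Finset PowerSeries

/-! ### Gaussian moments over a ring. -/

section GaussMoment

variable {R : Type*} [CommRing R]

/-- The Gaussian moments over a ring, in terms of the inverse `σ` of the chosen square root. -/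
noncomputable def gaussMoment (σ : R) (k : ℕ) : R :=
  if Even k then ((k - 1)‼ : R) * σ ^ (k + 1) else 0

/-- Integration by parts against the Gaussian weight. This recursion drives all the telescoping sums
below. -/
lemma gaussMoment_add_two (σ : R) (k : ℕ) :
    gaussMoment σ (k + 2) = ((k : R) + 1) * σ ^ 2 * gaussMoment σ k := by
  by_cases hk : Even k
  · have h2 : Even (k + 2) := hk.add even_two
    rw [gaussMoment, gaussMoment, if_pos hk, if_pos h2]
    rcases Nat.eq_zero_or_pos k with rfl | hpos
    · simp [Nat.doubleFactorial]; ring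
    · obtain ⟨m, rfl⟩ : ∃ m, k = m + 1 := ⟨k - 1, by omega⟩
      have : m + 1 + 2 - 1 = m + 2 := by omega
      rw [this, Nat.doubleFactorial_add_two, Nat.add_sub_cancel]
      push_cast
      ring
  · have h2 : ¬ Even (k + 2) := by simpa [Nat.even_add] using hk
    rw [gaussMoment, gaussMoment, if_neg hk, if_neg h2, mul_zero]

lemma gaussMoment_of_odd (σ : R) {k : ℕ} (hk : Odd k) : gaussMoment σ k = 0 :=
  if_neg (Nat.not_even_iff_odd.mpr hk)

lemma coeff_mul_pow_eq_zero {E : R⟦X⟧} (hE : coeff 0 E = 0) (G : R⟦X⟧) {k j : ℕ} (h : k < j) :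
    coeff k (G * E ^ j) = 0 := by
  have h1 : (X : R⟦X⟧) ∣ E := X_dvd_iff.mpr (by simpa using hE)
  exact X_pow_dvd_iff.mp ((pow_dvd_pow_of_dvd h1 j).mul_left G) k h

end GaussMoment

/-! ### Formal Gaussian integrals: integration by parts and homogeneity. -/

section GaussFunctional

variable {R : Type*} [CommRing R] [Algebra ℂ R]

/-- The inverse of `j!` in a `ℂ`-algebra. -/
noncomputable def invFactorial (R : Type*) [CommRing R] [Algebra ℂ R] (j : ℕ) : R :=
  algebraMap ℂ R (j ! : ℂ)⁻¹

@[simp] lemma invFactorial_zero : invFactorial R 0 = 1 := by simp [invFactorial]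

lemma succ_mul_invFactorial_succ (j : ℕ) :
    ((j : R) + 1) * invFactorial R (j + 1) = invFactorial R j := by
  have h1 : ((j : R) + 1) = algebraMap ℂ R ((j : ℂ) + 1) := by simp
  rw [invFactorial, invFactorial, h1, ← map_mul, Nat.factorial_succ]
  congr 1
  have : ((j : ℂ) + 1) ≠ 0 := by exact_mod_cast Nat.succ_ne_zero j
  push_cast
  field_simp

/-- Cancellation of a positive integer in a `ℂ`-algebra. -/
lemma natSucc_mul_cancel (n : ℕ) {a b : R} (h : ((n : R) + 1) * a = ((n : R) + 1) * b) :
    a = b := by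
  have h1 : ((n : R) + 1) = algebraMap ℂ R ((n : ℂ) + 1) := by simp
  have h2 : algebraMap ℂ R ((n : ℂ) + 1)⁻¹ * ((n : R) + 1) = 1 := by
    rw [h1, ← map_mul, inv_mul_cancel₀ (by exact_mod_cast Nat.succ_ne_zero n), map_one]
  calc a = algebraMap ℂ R ((n : ℂ) + 1)⁻¹ * ((n : R) + 1) * a := by rw [h2, one_mul]
    _ = algebraMap ℂ R ((n : ℂ) + 1)⁻¹ * ((n : R) + 1) * b := by rw [mul_assoc, h, ← mul_assoc]
    _ = b := by rw [h2, one_mul]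

/-- Two power series over a `ℂ`-algebra agree if their derivatives and constant terms do. -/
lemma eq_of_derivative_eq {f g : R⟦X⟧} (hD : d⁄dX R f = d⁄dX R g)
    (hc : coeff 0 f = coeff 0 g) : f = g := by
  ext n
  cases n with
  | zero => exact hc
  | succ n =>
    have h := congrArg (coeff n) hD
    rw [coeff_derivative, coeff_derivative, mul_comm, mul_comm (coeff (n + 1) g)] at h
    exact natSucc_mul_cancel n h

lemma gaussMoment_inv (s : ℂ) (k : ℕ) : gaussMoment s⁻¹ k = moment s k := by
  simp [gaussMoment, moment]

/-- The coefficient of `ħ^{k/2}` in the formal integral of `G` against `e^{S/ħ}`, where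
`S = t² (E + c)` and `σ = (-2c)^{-1/2}`. -/
noncomputable def gaussFunctional (σ : R) (E : R⟦X⟧) (k : ℕ) : R⟦X⟧ →ₗ[R] R :=
  ∑ j ∈ range (k + 1), (gaussMoment σ (k + 2 * j) * invFactorial R j) •
    (coeff k ∘ₗ LinearMap.mulRight R (E ^ j))

lemma gaussFunctional_apply (σ : R) (E : R⟦X⟧) (k : ℕ) (G : R⟦X⟧) :
    gaussFunctional σ E k G = ∑ j ∈ range (k + 1),
      gaussMoment σ (k + 2 * j) * invFactorial R j * coeff k (G * E ^ j) := by
  simp [gaussFunctional]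

/-- The powers E^j with j > k have order above k. Lengthening the sum is therefore free, which lets
orders k and k + 2 be compared over a common range. -/
lemma gaussFunctional_apply_of_le (σ : R) {E : R⟦X⟧} (hE : coeff 0 E = 0) {k N : ℕ}
    (hN : k < N) (G : R⟦X⟧) :
    gaussFunctional σ E k G = ∑ j ∈ range N,
      gaussMoment σ (k + 2 * j) * invFactorial R j * coeff k (G * E ^ j) := by
  rw [gaussFunctional_apply]
  refine sum_subset (range_subset_range.mpr hN) fun j _ hj => ?_
  rw [coeff_mul_pow_eq_zero hE G (by simpa using hj), mul_zero]

lemma gaussFunctional_of_odd (σ : R) (E : R⟦X⟧) {k : ℕ} (hk : Odd k) (G : R⟦X⟧) :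
    gaussFunctional σ E k G = 0 := by
  rw [gaussFunctional_apply]
  refine sum_eq_zero fun j _ => ?_
  rw [gaussMoment_of_odd σ (hk.add_even (even_two_mul j)), zero_mul, zero_mul]

lemma gaussFunctional_zero (σ : R) (E : R⟦X⟧) (G : R⟦X⟧) :
    gaussFunctional σ E 0 G = σ * coeff 0 G := by
  simp [gaussFunctional_apply, gaussMoment]

lemma gaussFunctional_C_mul (σ : R) (E : R⟦X⟧) (k : ℕ) (a : R) (G : R⟦X⟧) :
    gaussFunctional σ E k (C a * G) = a * gaussFunctional σ E k G := by
  rw [← smul_eq_C_mul, map_smul, smul_eq_mul]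

/-- Integration by parts. -/
lemma gaussFunctional_parts {σ c : R} (hσ : σ ^ 2 * (2 * c) = -1) {E : R⟦X⟧}
    (hE : coeff 0 E = 0) (k : ℕ) (G : R⟦X⟧) :
    gaussFunctional σ E (k + 2) (G * d⁄dX R (X ^ 2 * (E + C c))) +
      gaussFunctional σ E k (d⁄dX R G) = 0 := by
  rw [gaussFunctional_apply_of_le σ hE (show k + 2 < k + 3 by omega),
    gaussFunctional_apply_of_le σ hE (show k < k + 3 + 1 by omega)]
  set a : ℕ → R := fun j => coeff (k + 1) (G * E ^ j) with ha
  set b : ℕ → R := fun j => coeff k (d⁄dX R G * E ^ j) with hb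
  set m : ℕ → R := fun j => gaussMoment σ (k + 2 * j) * invFactorial R j with hm
  set u : ℕ → R := fun j => ((k : R) + 2 * j + 1) * m j * a j with hu
  -- The `u` differences telescope, and the remaining terms in `b` are those of the integral of G',
  -- shifted by one in j.
  have key : ∀ j, gaussMoment σ (k + 2 + 2 * j) * invFactorial R j *
      coeff (k + 2) (G * d⁄dX R (X ^ 2 * (E + C c)) * E ^ j) =
      u (j + 1) - u j - m (j + 1) * b (j + 1) := by
    intro j
    have h1 : G * d⁄dX R (X ^ 2 * (E + C c)) * E ^ j =
        X * (C (2 * c) * (G * E ^ j) + C 2 * (G * E ^ (j + 1)) +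
          X * (G * E ^ j * d⁄dX R E)) := by
      simp only [Derivation.leibniz, Derivation.leibniz_pow, map_add, derivative_C, derivative_X,
        smul_eq_mul, map_mul, nsmul_eq_mul, map_ofNat]
      push_cast
      ring
    -- E^j E' is traded for the derivative of G E^(j+1), so that only the sequences `a` and `b`
    -- occur.
    have h2 : ((j : R) + 1) * coeff k (G * E ^ j * d⁄dX R E) =
        ((k : R) + 1) * a (j + 1) - b (j + 1) := by
      have h3 : d⁄dX R (G * E ^ (j + 1)) =
          C ((j : R) + 1) * (G * E ^ j * d⁄dX R E) + d⁄dX R G * E ^ (j + 1) := by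
        simp only [Derivation.leibniz, Derivation.leibniz_pow, smul_eq_mul, nsmul_eq_mul,
          map_add, map_natCast, map_one, Nat.add_sub_cancel]
        push_cast
        ring
      have h4 := congrArg (coeff k) h3
      rw [coeff_derivative, map_add, coeff_C_mul] at h4
      simp only [ha, hb]
      linear_combination -h4
    have h5 : coeff (k + 2) (G * d⁄dX R (X ^ 2 * (E + C c)) * E ^ j) =
        2 * c * a j + 2 * a (j + 1) + coeff k (G * E ^ j * d⁄dX R E) := by
      rw [h1, coeff_succ_X_mul, map_add, map_add, coeff_C_mul, coeff_C_mul, coeff_succ_X_mul]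
    rw [h5]
    have e1 : k + 2 + 2 * j = k + 2 * j + 2 := by ring
    have e2 : k + 2 * (j + 1) = k + 2 * j + 2 := by ring
    simp only [hu, hm, e1, e2, ← succ_mul_invFactorial_succ (R := R) j]
    have h6 := gaussMoment_add_two σ (k + 2 * j)
    push_cast at h6 ⊢
    linear_combination (gaussMoment σ (k + 2 * j + 2)) * invFactorial R (j + 1) * h2 +
      2 * c * ((j : R) + 1) * invFactorial R (j + 1) * a j * h6 +
      ((k : R) + 2 * j + 1) * gaussMoment σ (k + 2 * j) * ((j : R) + 1) *
        invFactorial R (j + 1) * a j * hσ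
  rw [sum_congr rfl fun j _ => key j, sum_sub_distrib, sum_range_sub, sum_range_succ' _ (k + 3)]
  have hu0 : u 0 = m 0 * b 0 := by
    simp only [hu, ha, hb, pow_zero, mul_one, coeff_derivative]
    push_cast
    ring
  have huN : u (k + 3) = 0 := by
    simp only [hu, ha, coeff_mul_pow_eq_zero hE G (show k + 1 < k + 3 by omega), mul_zero]
  rw [huN, hu0]
  simp only [hm, hb]
  ring

/-- The homogeneity relation for the formal integral. -/
lemma gaussFunctional_euler {σ c : R} (hσ : σ ^ 2 * (2 * c) = -1) {E : R⟦X⟧}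
    (hE : coeff 0 E = 0) (k : ℕ) (G : R⟦X⟧) :
    ((k : R) + 1) * gaussFunctional σ E k G +
      2 * gaussFunctional σ E (k + 2) (G * (X ^ 2 * (E + C c))) = 0 := by
  rw [gaussFunctional_apply_of_le σ hE (show k + 2 < k + 3 by omega),
    gaussFunctional_apply_of_le σ hE (show k < k + 3 by omega), mul_sum, mul_sum,
    ← sum_add_distrib]
  set a : ℕ → R := fun j => coeff k (G * E ^ j) with ha
  set v : ℕ → R := fun j => 2 * j * (gaussMoment σ (k + 2 * j) * invFactorial R j) * a j with hv
  have key : ∀ j, ((k : R) + 1) *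
      (gaussMoment σ (k + 2 * j) * invFactorial R j * coeff k (G * E ^ j)) +
      2 * (gaussMoment σ (k + 2 + 2 * j) * invFactorial R j *
      coeff (k + 2) (G * (X ^ 2 * (E + C c)) * E ^ j)) = v (j + 1) - v j := by
    intro j
    have h1 : G * (X ^ 2 * (E + C c)) * E ^ j =
        X * (X * (C c * (G * E ^ j) + G * E ^ (j + 1))) := by ring
    rw [h1, coeff_succ_X_mul, coeff_succ_X_mul, map_add, coeff_C_mul]
    have e1 : k + 2 + 2 * j = k + 2 * j + 2 := by ring
    have e2 : k + 2 * (j + 1) = k + 2 * j + 2 := by ring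
    simp only [hv, ha, e1, e2, ← succ_mul_invFactorial_succ (R := R) j]
    have h6 := gaussMoment_add_two σ (k + 2 * j)
    push_cast at h6 ⊢
    linear_combination
      2 * c * ((j : R) + 1) * invFactorial R (j + 1) * coeff k (G * E ^ j) * h6 +
      ((k : R) + 2 * j + 1) * gaussMoment σ (k + 2 * j) * ((j : R) + 1) *
        invFactorial R (j + 1) * coeff k (G * E ^ j) * hσ
  rw [sum_congr rfl fun j _ => key j, sum_range_sub]
  simp only [hv, ha, coeff_mul_pow_eq_zero hE G (show k < k + 3 by omega)]
  simp

end GaussFunctional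

/-! ### Differentiation with respect to a parameter. -/

section Derivations

variable {R : Type*} [CommRing R] [Algebra ℂ R] (D : Derivation ℂ R R)

/-- The coefficientwise extension of a derivation to power series. -/
noncomputable def coeffDerivation : Derivation ℂ R⟦X⟧ R⟦X⟧ :=
  Derivation.mk'
    { toFun := fun F => PowerSeries.mk fun n => D (coeff n F)
      map_add' := fun F G => by ext n; simp
      map_smul' := fun a F => by ext n; simp }
    (fun F G => by
      ext n
      simp only [LinearMap.coe_mk, AddHom.coe_mk, coeff_mk, coeff_mul, map_add, smul_eq_mul,
        map_sum, Derivation.leibniz, sum_add_distrib]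
      congr 1
      rw [← Nat.sum_antidiagonal_swap]
      rfl)

@[simp] lemma coeff_coeffDerivation (F : R⟦X⟧) (n : ℕ) :
    coeff n (coeffDerivation D F) = D (coeff n F) := by
  simp [coeffDerivation]

@[simp] lemma coeffDerivation_C (a : R) : coeffDerivation D (C a) = C (D a) := by
  ext n
  simp only [coeff_coeffDerivation, coeff_C]
  split_ifs <;> simp

@[simp] lemma coeffDerivation_X : coeffDerivation D (X : R⟦X⟧) = 0 := by
  ext n
  simp only [coeff_coeffDerivation, coeff_X]
  split_ifs <;> simp

lemma derivative_coeffDerivation (F : R⟦X⟧) :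
    d⁄dX R (coeffDerivation D F) = coeffDerivation D (d⁄dX R F) := by
  ext n
  have h : ((n : R) + 1) = algebraMap ℂ R (n + 1) := by simp
  simp only [coeff_derivative, coeff_coeffDerivation, Derivation.leibniz, h,
    Derivation.map_algebraMap, smul_eq_mul]
  ring

/-- The weight is e^{cξ²}, so differentiating it brings down ξ² D c. Algebraically, the constraint
on σ forces D σ = σ³ D c. -/
lemma derivation_gaussMoment {σ c : R} (hσ : σ ^ 2 * (2 * c) = -1) (k : ℕ) :
    D (gaussMoment σ k) = gaussMoment σ (k + 2) * D c := by
  have h1 : D σ = σ ^ 3 * D c := by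
    have h := congrArg D hσ
    have h2 : D (2 : R) = 0 := by
      have := D.map_natCast 2
      simpa using this
    simp only [Derivation.leibniz, Derivation.leibniz_pow, map_neg, Derivation.map_one_eq_zero,
      smul_eq_mul, nsmul_eq_mul, h2] at h
    have h4 : (((1 : ℕ) : R) + 1) * D σ = (((1 : ℕ) : R) + 1) * (σ ^ 3 * D c) := by
      push_cast at h ⊢
      simp only [pow_one] at h
      linear_combination -σ * h + 2 * D σ * hσ
    exact natSucc_mul_cancel 1 h4
  rw [gaussMoment_add_two, gaussMoment]
  split_ifs with hk
  · simp only [Derivation.leibniz, Derivation.map_natCast, Derivation.leibniz_pow, smul_eq_mul,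
      nsmul_eq_mul, h1, Nat.add_sub_cancel]
    push_cast
    ring
  · simp

/-- Differentiation under the formal integral sign. -/
lemma derivation_gaussFunctional {σ c : R} (hσ : σ ^ 2 * (2 * c) = -1) {E : R⟦X⟧}
    (hE : coeff 0 E = 0) (k : ℕ) (G : R⟦X⟧) :
    D (gaussFunctional σ E k G) = gaussFunctional σ E k (coeffDerivation D G) +
      gaussFunctional σ E (k + 2) (G * coeffDerivation D (X ^ 2 * (E + C c))) := by
  rw [gaussFunctional_apply_of_le σ hE (show k < k + 3 by omega),
    gaussFunctional_apply_of_le σ hE (show k < k + 3 by omega),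
    gaussFunctional_apply_of_le σ hE (show k + 2 < k + 3 by omega), map_sum, ← sum_add_distrib,
    ← sub_eq_zero, ← sum_sub_distrib]
  set d : ℕ → R := fun j => coeff k (G * E ^ j * coeffDerivation D E) with hd
  -- At j = 0 the index j - 1 truncates to 0, but the factor j kills the term.
  set e : ℕ → R := fun j => j * (gaussMoment σ (k + 2 * j) * invFactorial R j) * d (j - 1) with he
  have key : ∀ j, D (gaussMoment σ (k + 2 * j) * invFactorial R j * coeff k (G * E ^ j)) -
      (gaussMoment σ (k + 2 * j) * invFactorial R j * coeff k (coeffDerivation D G * E ^ j) +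
      gaussMoment σ (k + 2 + 2 * j) * invFactorial R j *
        coeff (k + 2) (G * coeffDerivation D (X ^ 2 * (E + C c)) * E ^ j)) = -(e (j + 1) - e j) := by
    intro j
    have h1 : G * coeffDerivation D (X ^ 2 * (E + C c)) * E ^ j =
        X * (X * (C (D c) * (G * E ^ j) + G * E ^ j * coeffDerivation D E)) := by
      simp only [Derivation.leibniz, Derivation.leibniz_pow, map_add, coeffDerivation_C,
        coeffDerivation_X, smul_eq_mul, nsmul_eq_mul]
      ring
    have h2 : D (coeff k (G * E ^ j)) = coeff k (coeffDerivation D G * E ^ j) + j * d (j - 1) := by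
      rw [← coeff_coeffDerivation]
      have h3 : coeffDerivation D (G * E ^ j) = coeffDerivation D G * E ^ j +
          C (j : R) * (G * E ^ (j - 1) * coeffDerivation D E) := by
        simp only [Derivation.leibniz, Derivation.leibniz_pow, smul_eq_mul, nsmul_eq_mul,
          map_natCast]
        ring
      rw [h3, map_add, coeff_C_mul]
    have h4 : D (invFactorial R j) = 0 := D.map_algebraMap _
    rw [h1, coeff_succ_X_mul, coeff_succ_X_mul, map_add, coeff_C_mul]
    have e1 : k + 2 + 2 * j = k + 2 * j + 2 := by ring
    have e2 : k + 2 * (j + 1) = k + 2 * j + 2 := by ring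
    simp only [he, e1, e2, Derivation.leibniz, smul_eq_mul, h4, h2,
      derivation_gaussMoment D hσ, Nat.add_sub_cancel]
    push_cast
    linear_combination gaussMoment σ (k + 2 * j + 2) * d j * succ_mul_invFactorial_succ (R := R) j
  rw [sum_congr rfl fun j _ => key j, sum_neg_distrib, sum_range_sub]
  have hN : e (k + 3) = 0 := by
    have : G * E ^ (k + 3 - 1) * coeffDerivation D E =
        G * coeffDerivation D E * E ^ (k + 2) := by
      rw [show k + 3 - 1 = k + 2 by omega]; ring
    simp only [he, hd, this,
      coeff_mul_pow_eq_zero hE (G * coeffDerivation D E) (show k < k + 2 by omega), mul_zero]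
  rw [hN]
  simp [he]

end Derivations

/-! ### Operators graded by powers of √ħ. -/

section Convolution

variable {R : Type*} [CommRing R]

/-- The action on series in `h` of the operator `∑ₖ hᵏ Pₖ`. -/
noncomputable def convolve (P : ℕ → R → R) (F : R⟦X⟧) : R⟦X⟧ :=
  PowerSeries.mk fun n => ∑ p ∈ antidiagonal n, P p.1 (coeff p.2 F)

lemma coeff_convolve (P : ℕ → R → R) (F : R⟦X⟧) (n : ℕ) :
    coeff n (convolve P F) = ∑ p ∈ antidiagonal n, P p.1 (coeff p.2 F) :=
  coeff_mk _ _

/-- The calculus rules relate order k + 2 to order k; in generating form that shift is a factor X² =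
ħ. -/
lemma convolve_eq_X_sq_mul {P Q : ℕ → R → R} (h0 : ∀ f, P 0 f = 0) (h1 : ∀ f, P 1 f = 0)
    (h : ∀ k f, P (k + 2) f = Q k f) (F : R⟦X⟧) : convolve P F = X ^ 2 * convolve Q F := by
  ext n
  rw [pow_two, mul_assoc]
  match n with
  | 0 => simp [coeff_convolve, h0]
  | 1 => simp [coeff_convolve, h0, h1, Nat.antidiagonal_succ, coeff_succ_X_mul]
  | n + 2 =>
    rw [coeff_succ_X_mul, coeff_succ_X_mul, coeff_convolve, coeff_convolve,
      Nat.sum_antidiagonal_succ, Nat.sum_antidiagonal_succ]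
    simp [h0, h1, h]

lemma convolve_X_mul {P : ℕ → R → R} (h0 : ∀ k, P k 0 = 0) (F : R⟦X⟧) :
    convolve P (X * F) = X * convolve P F := by
  ext n
  cases n with
  | zero => simp [coeff_convolve, h0]
  | succ n => simp [coeff_succ_X_mul, coeff_convolve, Nat.sum_antidiagonal_succ', h0]

end Convolution

/-! ### The saddle point operator and its three identities. -/

section Operators

variable {R : Type*} [CommRing R] [Algebra ℂ R] (D : Derivation ℂ R R)

/-- The Taylor expansion `∑ₙ tⁿ Dⁿ f / n!`. -/
noncomputable def taylor : R →ₗ[ℂ] R⟦X⟧ where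
  toFun f := PowerSeries.mk fun n => invFactorial R n * D^[n] f
  map_add' f g := by ext n; simp [iterate_map_add, mul_add]
  map_smul' a f := by
    ext n
    have : D^[n] (a • f) = a • D^[n] f := by
      induction n with
      | zero => rfl
      | succ n ih => rw [Function.iterate_succ_apply', ih, D.map_smul, Function.iterate_succ_apply']
    simp [this]

@[simp] lemma coeff_taylor (f : R) (n : ℕ) :
    coeff n (taylor D f) = invFactorial R n * D^[n] f := by
  simp [taylor]

@[simp] lemma constantCoeff_taylor (f : R) : constantCoeff (taylor D f) = f := by
  rw [← coeff_zero_eq_constantCoeff_apply, coeff_taylor]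
  simp

lemma derivative_taylor (f : R) : d⁄dX R (taylor D f) = taylor D (D f) := by
  ext n
  rw [coeff_derivative, coeff_taylor, coeff_taylor, ← succ_mul_invFactorial_succ n,
    Function.iterate_succ_apply]
  ring

/-- With `derivative_taylor`: f(z + t) has the same derivative in z as in t. -/
lemma coeffDerivation_taylor (f : R) : coeffDerivation D (taylor D f) = taylor D (D f) := by
  ext n
  have h : D (invFactorial R n) = 0 := D.map_algebraMap _
  rw [coeff_coeffDerivation, coeff_taylor, coeff_taylor, Derivation.leibniz, h, smul_zero,
    add_zero, smul_eq_mul, ← Function.iterate_succ_apply, Function.iterate_succ_apply']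

lemma taylor_mul (f g : R) : taylor D (f * g) = taylor D f * taylor D g := by
  ext n
  induction n generalizing f g with
  | zero => simp [coeff_mul]
  | succ n ih =>
    have h : coeff n (d⁄dX R (taylor D (f * g))) = coeff n (d⁄dX R (taylor D f * taylor D g)) := by
      simp only [Derivation.leibniz, smul_eq_mul, map_add, derivative_taylor]
      rw [ih, ih]
    rw [coeff_derivative, coeff_derivative, mul_comm, mul_comm (coeff _ _)] at h
    exact natSucc_mul_cancel n h

/-- The terms of order at least three, divided by `t²`, of the series `S` with
`S' = (p(z + t) - p(z)) q'(z + t)`. -/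
noncomputable def phaseTerms (p q : R) : R⟦X⟧ :=
  PowerSeries.mk fun m => if m = 0 then 0 else
    algebraMap ℂ R ((m + 2 : ℂ)⁻¹) * coeff (m + 1) ((taylor D p - C p) * taylor D (D q))

/-- Half the second derivative of the phase at its critical point. -/
noncomputable def phaseHessian (p q : R) : R := algebraMap ℂ R (2⁻¹ : ℂ) * (D p * D q)

/-- The power series `S` with `S' = (p(z + t) - p(z)) q'(z + t)` and `S(0) = 0`. -/
noncomputable def phaseSeries (p q : R) : R⟦X⟧ :=
  X ^ 2 * (phaseTerms D p q + C (phaseHessian D p q))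

lemma coeff_zero_phaseTerms (p q : R) : coeff 0 (phaseTerms D p q) = 0 := by
  simp [phaseTerms]

lemma two_mul_phaseHessian (p q : R) : 2 * phaseHessian D p q = D p * D q := by
  have h : (2 : R) = algebraMap ℂ R 2 := (map_ofNat _ 2).symm
  rw [phaseHessian, ← mul_assoc, h, ← map_mul]
  simp

lemma derivative_phaseSeries (p q : R) :
    d⁄dX R (phaseSeries D p q) = (taylor D p - C p) * taylor D (D q) := by
  ext n
  rw [coeff_derivative, phaseSeries, pow_two, mul_assoc, coeff_succ_X_mul]
  match n with
  | 0 => simp [coeff_mul]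
  | 1 =>
    have h := two_mul_phaseHessian D p q
    rw [coeff_succ_X_mul, map_add, coeff_zero_phaseTerms, coeff_C, if_pos rfl]
    simp only [coeff_mul, Nat.antidiagonal_succ, Nat.antidiagonal_zero]
    have h1 : invFactorial R 1 = 1 := by simp [invFactorial]
    simp [h1]
    linear_combination h
  | m + 2 =>
    have h : algebraMap ℂ R ((m : ℂ) + 3)⁻¹ * ((m : R) + 3) = 1 := by
      have h1 : ((m : R) + 3) = algebraMap ℂ R ((m : ℂ) + 3) := by
        rw [map_add, map_natCast, map_ofNat]
      rw [h1, ← map_mul, inv_mul_cancel₀ (by exact_mod_cast (show m + 3 ≠ 0 by omega)), map_one]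
    rw [coeff_succ_X_mul, map_add, coeff_C, if_neg (by omega), add_zero, phaseTerms, coeff_mk,
      if_neg (by omega)]
    have e : (((m + 1 : ℕ) : ℂ) + 2) = (m : ℂ) + 3 := by push_cast; ring
    rw [e]
    push_cast
    linear_combination coeff (m + 1 + 1) ((taylor D p - C p) * taylor D (D q)) * h

lemma coeff_zero_phaseSeries (p q : R) : coeff 0 (phaseSeries D p q) = 0 := by
  simp [phaseSeries, pow_two, mul_assoc]

/-- With ω a primitive of p dq, the phase is ω(χ) - ω(z) - p(z)(q(χ) - q(z)). Multiplication by S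
thus reduces to multiplication by ω and q inside and outside the integral. -/
lemma phaseSeries_eq_of_primitive {p q ω : R} (hω : D ω = p * D q) :
    phaseSeries D p q = taylor D ω - C ω - C p * (taylor D q - C q) := by
  apply eq_of_derivative_eq
  · rw [derivative_phaseSeries]
    simp only [map_sub, Derivation.leibniz, derivative_C, derivative_taylor, smul_eq_mul, hω,
      taylor_mul]
    ring
  · rw [coeff_zero_phaseSeries, map_sub, map_sub, coeff_C_mul]
    simp

/-- The phase depends on z through χ = z + t, which contributes ∂S/∂t, and through the base point,
which contributes p'(z)(q(z) - q(χ)). -/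
lemma coeffDerivation_phaseSeries (p q : R) :
    coeffDerivation D (phaseSeries D p q) =
      C (D p) * (C q - taylor D q) + d⁄dX R (phaseSeries D p q) := by
  apply eq_of_derivative_eq
  · rw [derivative_coeffDerivation, map_add, derivative_phaseSeries]
    simp only [map_sub, Derivation.leibniz, derivative_C, derivative_taylor, smul_eq_mul,
      coeffDerivation_taylor, coeffDerivation_C]
    ring
  · rw [coeff_coeffDerivation, coeff_zero_phaseSeries, map_add, derivative_phaseSeries,
      coeff_C_mul, coeff_mul]
    simp

/-- The coefficient of `ħ^{k/2}` in the formal integral of `f(χ) q'(χ) e^{S(χ)/ħ}`. -/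
noncomputable def saddleCoeff (p q σ : R) (k : ℕ) (f : R) : R :=
  gaussFunctional σ (phaseTerms D p q) k (taylor D (f * D q))

/-- The formal integral of `f(χ) q'(χ) e^{S(χ)/ħ}` as an operator on series in `√ħ`. -/
noncomputable def saddleOp (p q σ : R) : R⟦X⟧ → R⟦X⟧ := convolve (saddleCoeff D p q σ)

variable (p q σ : R)

lemma saddleCoeff_add (k : ℕ) (f g : R) :
    saddleCoeff D p q σ k (f + g) = saddleCoeff D p q σ k f + saddleCoeff D p q σ k g := by
  simp [saddleCoeff, add_mul]

lemma saddleCoeff_smul (k : ℕ) (a : ℂ) (f : R) :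
    saddleCoeff D p q σ k (a • f) = a • saddleCoeff D p q σ k f := by
  have h : (a • taylor D (f * D q)) = (algebraMap ℂ R a) • taylor D (f * D q) := by
    ext n; rw [smul_eq_C_mul, coeff_C_mul, ← Algebra.smul_def]; rfl
  rw [saddleCoeff, smul_mul_assoc, map_smul, h, map_smul, saddleCoeff, smul_eq_mul,
    Algebra.smul_def]

lemma saddleCoeff_zero_right (k : ℕ) : saddleCoeff D p q σ k 0 = 0 := by
  simp [saddleCoeff]

lemma saddleCoeff_zero (f : R) : saddleCoeff D p q σ 0 f = σ * (f * D q) := by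
  simp [saddleCoeff, gaussFunctional_zero]

lemma saddleCoeff_of_odd {k : ℕ} (hk : Odd k) (f : R) : saddleCoeff D p q σ k f = 0 :=
  gaussFunctional_of_odd _ _ hk _

variable {p q σ}

lemma sq_mul_phaseHessian (hσ : σ ^ 2 * (D p * D q) = -1) :
    σ ^ 2 * (2 * phaseHessian D p q) = -1 := by
  rw [two_mul_phaseHessian, hσ]

/-- (p(χ) - p(z)) q'(χ) is ∂S/∂χ, so this is integration by parts with f itself as the amplitude;
the factor v restores the q' built into the operator. -/
lemma saddleCoeff_parts (hσ : σ ^ 2 * (D p * D q) = -1) {v : R} (hv : v * D q = 1)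
    (k : ℕ) (f : R) :
    saddleCoeff D p q σ (k + 2) (p * f) - p * saddleCoeff D p q σ (k + 2) f =
      -saddleCoeff D p q σ k (v * D f) := by
  have h := gaussFunctional_parts (sq_mul_phaseHessian D hσ) (coeff_zero_phaseTerms D p q) k
    (taylor D f)
  have h1 : taylor D f * d⁄dX R (phaseSeries D p q) =
      taylor D (p * f * D q) - C p * taylor D (f * D q) := by
    rw [derivative_phaseSeries]
    simp only [taylor_mul]
    ring
  rw [phaseSeries] at h1
  rw [h1, map_sub, gaussFunctional_C_mul, derivative_taylor] at h
  have h2 : v * D f * D q = D f := by linear_combination D f * hv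
  simp only [saddleCoeff, h2]
  linear_combination h

/-- Differentiating in z under the integral at fixed t produces a total t-derivative, removed by
integration by parts, and the factor p'(z)(q(z) - q(χ)). -/
lemma saddleCoeff_mul_sub (hσ : σ ^ 2 * (D p * D q) = -1) {u : R} (hu : u * D p = 1)
    (k : ℕ) (f : R) :
    saddleCoeff D p q σ (k + 2) (q * f) - q * saddleCoeff D p q σ (k + 2) f =
      -(u * D (saddleCoeff D p q σ k f)) := by
  have hE := coeff_zero_phaseTerms D p q
  have h := derivation_gaussFunctional D (sq_mul_phaseHessian D hσ) hE k (taylor D (f * D q))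
  have h' := gaussFunctional_parts (sq_mul_phaseHessian D hσ) hE k (taylor D (f * D q))
  have h1 : taylor D (f * D q) * coeffDerivation D (phaseSeries D p q) =
      C (D p) * (C q * taylor D (f * D q) - taylor D (q * f * D q)) +
      taylor D (f * D q) * d⁄dX R (phaseSeries D p q) := by
    rw [coeffDerivation_phaseSeries]
    simp only [taylor_mul]
    ring
  rw [phaseSeries] at h1
  rw [h1, map_add, gaussFunctional_C_mul, map_sub, gaussFunctional_C_mul,
    coeffDerivation_taylor] at h
  rw [derivative_taylor] at h'
  simp only [saddleCoeff]
  linear_combination u * h + u * h' - (gaussFunctional σ (phaseTerms D p q) (k + 2)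
    (taylor D (q * f * D q)) - q * gaussFunctional σ (phaseTerms D p q) (k + 2)
    (taylor D (f * D q))) * hu

lemma saddleCoeff_euler (hσ : σ ^ 2 * (D p * D q) = -1) {ω : R} (hω : D ω = p * D q)
    (k : ℕ) (f : R) :
    2 * p * (saddleCoeff D p q σ (k + 2) (q * f) - q * saddleCoeff D p q σ (k + 2) f) -
      2 * (saddleCoeff D p q σ (k + 2) (ω * f) - ω * saddleCoeff D p q σ (k + 2) f) =
      ((k : R) + 1) * saddleCoeff D p q σ k f := by
  have h := gaussFunctional_euler (sq_mul_phaseHessian D hσ) (coeff_zero_phaseTerms D p q) k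
    (taylor D (f * D q))
  have h1 : taylor D (f * D q) * phaseSeries D p q =
      taylor D (ω * f * D q) - C ω * taylor D (f * D q) -
        C p * (taylor D (q * f * D q) - C q * taylor D (f * D q)) := by
    rw [phaseSeries_eq_of_primitive D hω]
    simp only [taylor_mul]
    ring
  rw [phaseSeries] at h1
  rw [h1, map_sub, map_sub, gaussFunctional_C_mul, gaussFunctional_C_mul, map_sub,
    gaussFunctional_C_mul] at h
  simp only [saddleCoeff]
  linear_combination -h

variable (p q σ)

lemma saddleOp_add (F G : R⟦X⟧) :
    saddleOp D p q σ (F + G) = saddleOp D p q σ F + saddleOp D p q σ G := by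
  ext n
  simp [saddleOp, coeff_convolve, saddleCoeff_add, sum_add_distrib]

lemma saddleOp_smul (a : ℂ) (F : R⟦X⟧) :
    saddleOp D p q σ (a • F) = a • saddleOp D p q σ F := by
  ext n
  have h (n : ℕ) (G : R⟦X⟧) : coeff n (a • G) = a • coeff n G := rfl
  simp [saddleOp, coeff_convolve, saddleCoeff_smul, smul_sum, h]

lemma saddleOp_sub (F G : R⟦X⟧) :
    saddleOp D p q σ (F - G) = saddleOp D p q σ F - saddleOp D p q σ G := by
  rw [eq_sub_iff_add_eq, ← saddleOp_add, sub_add_cancel]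

lemma saddleOp_X_mul (F : R⟦X⟧) : saddleOp D p q σ (X * F) = X * saddleOp D p q σ F :=
  convolve_X_mul (saddleCoeff_zero_right D p q σ) F

lemma coeff_zero_saddleOp (F : R⟦X⟧) :
    coeff 0 (saddleOp D p q σ F) = σ * (coeff 0 F * D q) := by
  simp [saddleOp, coeff_convolve, saddleCoeff_zero]

lemma convolve_saddleCoeff_comm (a : R) (F : R⟦X⟧) :
    convolve (fun k f => saddleCoeff D p q σ k (a * f) - a * saddleCoeff D p q σ k f) F =
      saddleOp D p q σ (C a * F) - C a * saddleOp D p q σ F := by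
  ext n
  simp [saddleOp, coeff_convolve, sum_sub_distrib, mul_sum, coeff_C_mul]

variable {p q σ}

lemma saddleOp_parts (hσ : σ ^ 2 * (D p * D q) = -1) {v : R} (hv : v * D q = 1) (F : R⟦X⟧) :
    saddleOp D p q σ (C p * F) - C p * saddleOp D p q σ F =
      -(X ^ 2 * saddleOp D p q σ (C v * coeffDerivation D F)) := by
  rw [← convolve_saddleCoeff_comm, convolve_eq_X_sq_mul (fun f => ?_) (fun f => ?_)
    (saddleCoeff_parts D hσ hv), ← mul_neg]
  · congr 1
    ext n
    simp [saddleOp, coeff_convolve, coeff_C_mul]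
  · simp only [saddleCoeff_zero]; ring
  · simp only [saddleCoeff_of_odd D p q σ odd_one]; ring

lemma saddleOp_mul_sub (hσ : σ ^ 2 * (D p * D q) = -1) {u : R} (hu : u * D p = 1) (F : R⟦X⟧) :
    saddleOp D p q σ (C q * F) - C q * saddleOp D p q σ F =
      -(X ^ 2 * (C u * coeffDerivation D (saddleOp D p q σ F))) := by
  rw [← convolve_saddleCoeff_comm, convolve_eq_X_sq_mul (fun f => ?_) (fun f => ?_)
    (saddleCoeff_mul_sub D hσ hu), ← mul_neg]
  · congr 1
    ext n
    simp [saddleOp, coeff_convolve, coeff_C_mul, mul_sum]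
  · simp only [saddleCoeff_zero]; ring
  · simp only [saddleCoeff_of_odd D p q σ odd_one]; ring

/-- The operator X d/dX is 2ħ∂_ħ. Applied to ħ^{-1/2} e^{S/ħ} it gives the factor -1 - 2S/ħ, and S
is then expanded through ω. -/
lemma saddleOp_euler (hσ : σ ^ 2 * (D p * D q) = -1) {ω : R} (hω : D ω = p * D q) (F : R⟦X⟧) :
    2 * C p * (saddleOp D p q σ (C q * F) - C q * saddleOp D p q σ F) -
      2 * (saddleOp D p q σ (C ω * F) - C ω * saddleOp D p q σ F) =
      X ^ 2 * (X * d⁄dX R (saddleOp D p q σ F) - saddleOp D p q σ (X * d⁄dX R F) +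
        saddleOp D p q σ F) := by
  have h2 : (2 : R⟦X⟧) = C 2 := (map_ofNat C 2).symm
  have h := convolve_eq_X_sq_mul (P := fun k f =>
    2 * p * (saddleCoeff D p q σ k (q * f) - q * saddleCoeff D p q σ k f) -
      2 * (saddleCoeff D p q σ k (ω * f) - ω * saddleCoeff D p q σ k f))
    (fun f => by simp only [saddleCoeff_zero]; ring)
    (fun f => by simp only [saddleCoeff_of_odd D p q σ odd_one]; ring)
    (saddleCoeff_euler D hσ hω) F
  have hX (G : R⟦X⟧) (n : ℕ) : coeff n (X * d⁄dX R G) = n * coeff n G := by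
    cases n with
    | zero => simp
    | succ n => rw [coeff_succ_X_mul, coeff_derivative]; push_cast; ring
  have hN : convolve (fun k f => ((k : R) + 1) * saddleCoeff D p q σ k f) F =
      X * d⁄dX R (saddleOp D p q σ F) - saddleOp D p q σ (X * d⁄dX R F) +
        saddleOp D p q σ F := by
    ext n
    simp only [map_add, map_sub, hX, saddleOp, coeff_convolve]
    rw [mul_sum, ← sum_sub_distrib, ← sum_add_distrib]
    refine sum_congr rfl fun x hx => ?_
    have h1 : ((x.2 : R) * coeff x.2 F) = (x.2 : ℂ) • coeff x.2 F := by
      simp [Algebra.smul_def]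
    have h3 : ((n : R)) = x.1 + x.2 := by rw [← mem_antidiagonal.mp hx]; push_cast; rfl
    rw [h1, saddleCoeff_smul, h3, Algebra.smul_def, map_natCast]
    ring
  rw [← hN, ← h, ← convolve_saddleCoeff_comm, ← convolve_saddleCoeff_comm, h2, ← map_mul]
  ext n
  simp only [map_sub, coeff_C_mul, coeff_convolve, sum_sub_distrib, ← mul_sum]

end Operators

/-! ### Inversion over formal Taylor series. -/

section Inversion

/-- An `h`-linear operator on series in `h` over `ℂ⟦w⟧` commuting with multiplication by a local
coordinate is a multiplication operator. -/
lemma eq_mul_of_commute {A : ℂ⟦X⟧⟦X⟧ →ₗ[ℂ] ℂ⟦X⟧⟦X⟧} (hX : ∀ F, A (X * F) = X * A F)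
    {y : ℂ⟦X⟧} (hy : coeff 1 y ≠ 0) (hA : ∀ F, A (C y * F) = C y * A F) (F : ℂ⟦X⟧⟦X⟧) :
    A F = F * A 1 := by
  have hC (a : ℂ) (G : ℂ⟦X⟧⟦X⟧) : C (C a) * G = a • G := by
    ext n m
    rw [coeff_C_mul, coeff_C_mul]
    rfl
  -- Subtracting its constant term turns y into w times a unit v, where w is the inner variable.
  obtain ⟨v, hv⟩ : (X : ℂ⟦X⟧) ∣ y - C (coeff 0 y) := X_dvd_iff.mpr (by simp)
  have hv0 : constantCoeff v ≠ 0 := by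
    have h := congrArg (coeff 1) hv
    rw [coeff_succ_X_mul, map_sub, coeff_C, if_neg one_ne_zero, sub_zero] at h
    rw [← coeff_zero_eq_constantCoeff_apply, ← h]
    exact hy
  have hAY (G : ℂ⟦X⟧⟦X⟧) : A (C (X * v) * G) = C (X * v) * A G := by
    rw [← hv, map_sub, sub_mul, sub_mul, map_sub, hA, hC, hC, map_smul]
  -- Bootstrap in the inner variable w: writing f = f(0) + (wv)(v⁻¹g), the error for f is wv times
  -- the error for v⁻¹g. So it is divisible by every power of w.
  have hconst (N : ℕ) : ∀ f : ℂ⟦X⟧, ∃ G, A (C f) - C f * A 1 = C (X ^ N) * G := by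
    induction N with
    | zero => exact fun f => ⟨A (C f) - C f * A 1, by rw [pow_zero, map_one C, one_mul]⟩
    | succ N ih =>
      intro f
      obtain ⟨g, hg⟩ : (X : ℂ⟦X⟧) ∣ f - C (coeff 0 f) := X_dvd_iff.mpr (by simp)
      obtain ⟨G, hG⟩ := ih (v⁻¹ * g)
      refine ⟨C v * G, ?_⟩
      have hf : C f = C (C (coeff 0 f)) * 1 + C (X * v) * C (v⁻¹ * g) := by
        rw [mul_one, ← map_mul, ← map_add]
        congr 1
        have : v * v⁻¹ = 1 := PowerSeries.mul_inv_cancel v hv0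
        linear_combination hg - X * g * this
      have h1 : A (C f) = C (C (coeff 0 f)) * A 1 + C (X * v) * A (C (v⁻¹ * g)) := by
        rw [hf, map_add, hAY, hC, hC, map_smul]
      rw [h1, hf, mul_one, pow_succ, map_mul C _ X, map_mul C X v]
      linear_combination C X * C v * hG
  have hconst' (f : ℂ⟦X⟧) : A (C f) = C f * A 1 := by
    rw [← sub_eq_zero]
    ext n m
    obtain ⟨G, hG⟩ := hconst (m + 1) f
    rw [hG, coeff_C_mul, map_zero, map_zero]
    exact X_pow_dvd_iff.mp (dvd_mul_right _ _) m m.lt_succ_self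
  -- The same bootstrap in the outer variable, now using that A commutes with it.
  have hall (N : ℕ) : ∀ F, ∃ G, A F - F * A 1 = X ^ N * G := by
    induction N with
    | zero => exact fun F => ⟨_, by rw [pow_zero, one_mul]⟩
    | succ N ih =>
      intro F
      obtain ⟨F', hF'⟩ : (X : ℂ⟦X⟧⟦X⟧) ∣ F - C (coeff 0 F) := X_dvd_iff.mpr (by simp)
      obtain ⟨G, hG⟩ := ih F'
      refine ⟨G, ?_⟩
      rw [sub_eq_iff_eq_add.mp hF', map_add, hX, hconst', pow_succ]
      linear_combination X * hG
  rw [← sub_eq_zero]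
  ext1 n
  obtain ⟨G, hG⟩ := hall (n + 1) F
  rw [hG, map_zero]
  exact X_pow_dvd_iff.mp (dvd_mul_right _ _) n n.lt_succ_self

/-- The two formal saddle point transforms are mutually inverse up to a constant factor. -/
theorem saddleOp_saddleOp {p q σ τ : ℂ⟦X⟧}
    (hσ : σ ^ 2 * (d⁄dX ℂ p * d⁄dX ℂ q) = -1) (hτ : τ ^ 2 * (d⁄dX ℂ p * d⁄dX ℂ q) = 1)
    (F : ℂ⟦X⟧⟦X⟧) :
    saddleOp (d⁄dX ℂ) (-q) p τ (saddleOp (d⁄dX ℂ) p q σ F) =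
      F * C (τ * σ * (d⁄dX ℂ p * d⁄dX ℂ q)) := by
  set D : Derivation ℂ ℂ⟦X⟧ ℂ⟦X⟧ := d⁄dX ℂ with hD
  set U := saddleOp D p q σ with hU
  set V := saddleOp D (-q) p τ with hV
  -- When this line is reached as part of the proof setup, the sign of -q turns the condition on τ
  -- into the one required of σ for the pair (-q, p).
  have hτ' : τ ^ 2 * (D (-q) * D p) = -1 := by
    rw [map_neg]; linear_combination -hτ
  have hu : (τ ^ 2 * D q) * D p = 1 := by linear_combination hτ
  have hv : (τ ^ 2 * D p) * D q = 1 := by linear_combination hτ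
  set u := τ ^ 2 * D q
  set v := τ ^ 2 * D p
  have hv' : -v * D (-q) = 1 := by rw [map_neg]; linear_combination hv
  have U1 := saddleOp_mul_sub D hσ hu
  have V1 := saddleOp_mul_sub D hτ' hv'
  have V2 := saddleOp_parts D hτ' hu
  -- Formal antiderivative of p dq; at n = 0 division by zero sets the constant term to 0, and any
  -- constant would do.
  obtain ⟨ω, hω⟩ : ∃ ω : ℂ⟦X⟧, D ω = p * D q := by
    refine ⟨PowerSeries.mk fun n => coeff (n - 1) (p * D q) / n, ?_⟩
    ext n
    rw [hD, coeff_derivative, coeff_mk, Nat.add_sub_cancel]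
    push_cast
    exact div_mul_cancel₀ _ (by exact_mod_cast Nat.succ_ne_zero n)
  have hω' : D (ω - p * q) = -q * D p := by
    rw [map_sub, Derivation.leibniz, hω, smul_eq_mul, smul_eq_mul]; ring
  have UE := saddleOp_euler D hσ hω 1
  have VE := saddleOp_euler D hτ' hω' (U 1)
  rw [← hU] at U1 UE
  rw [← hV] at V1 V2 VE
  have hVX2 (G : ℂ⟦X⟧⟦X⟧) : V (X ^ 2 * G) = X ^ 2 * V G := by
    rw [hV, pow_two, mul_assoc, saddleOp_X_mul, saddleOp_X_mul, mul_assoc]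
  have hVs (F G : ℂ⟦X⟧⟦X⟧) : V (F - G) = V F - V G := saddleOp_sub D _ _ _ F G
  have hVa (F G : ℂ⟦X⟧⟦X⟧) : V (F + G) = V F + V G := saddleOp_add D _ _ _ F G
  let A : ℂ⟦X⟧⟦X⟧ →ₗ[ℂ] ℂ⟦X⟧⟦X⟧ :=
    { toFun := fun F => V (U F)
      map_add' := fun F G => by rw [hU, saddleOp_add, ← hU, hVa]
      map_smul' := fun a F => by
        rw [hU, saddleOp_smul, hV, saddleOp_smul]; rfl }
  have hmul : ∀ F, V (U F) = F * V (U 1) := by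
    refine eq_mul_of_commute (A := A) (fun F => ?_) (y := q) ?_ (fun F => ?_)
    · change V (U (X * F)) = X * V (U F)
      rw [hU, saddleOp_X_mul, hV, saddleOp_X_mul]
    · intro h
      have h1 := congrArg (coeff 0) hv
      have h2 : coeff 0 (D q) = 0 := by rw [hD, coeff_derivative, h, zero_mul]
      simp only [coeff_zero_eq_constantCoeff, map_mul, map_one] at h1 h2
      rw [h2, mul_zero] at h1
      exact zero_ne_one h1
    -- The ħ-term from differentiating U F in z cancels the ħ-term from integrating by parts in V.
    · change V (U (C q * F)) = C q * V (U F)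
      have e1 := V2 (U F)
      have e2 : U (C q * F) = C q * U F - X ^ 2 * (C u * coeffDerivation D (U F)) := by
        linear_combination U1 F
      have e3 : V (C (-q) * U F) = - V (C q * U F) := by
        have := hVa (C (-q) * U F) (C q * U F)
        rw [← add_mul, ← map_add, neg_add_cancel, map_zero, zero_mul] at this
        have h0 : V 0 = 0 := by simpa using hVs 0 0
        rw [h0] at this
        linear_combination -this
      rw [e2, hVs, hVX2]
      rw [e3, map_neg] at e1
      linear_combination -e1
  set a := V (U 1) with ha
  -- Apply V to the scaling identity of U at 1 and add the scaling identity of V at U 1. The terms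
  -- V(X d/dX U 1) and the ω terms cancel. The remaining 2ħa is matched by differentiating qa in
  -- `V1`, where v q' = 1.
  have hN : X * d⁄dX ℂ⟦X⟧ a = 0 := by
    have h2 : V (2 * C p * (U (C q * 1) - C q * U 1) - 2 * (U (C ω * 1) - C ω * U 1)) =
        2 * (V (C p * U (C q * 1)) - V (C (p * q) * U 1)) -
          2 * (C ω * a - V (C ω * U 1)) := by
      have h3 : 2 * C p * (U (C q * 1) - C q * U 1) - 2 * (U (C ω * 1) - C ω * U 1) =
        (C p * U (C q * 1) - C (p * q) * U 1) + (C p * U (C q * 1) - C (p * q) * U 1) -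
          ((U (C ω * 1) - C ω * U 1) + (U (C ω * 1) - C ω * U 1)) := by
        rw [map_mul]; ring
      rw [h3, hVs, hVa, hVa, hVs, hVs, hmul (C ω * 1)]
      ring
    have hU0 : U (X * d⁄dX ℂ⟦X⟧ (1 : ℂ⟦X⟧⟦X⟧)) = 0 := by
      rw [derivative_one, mul_zero]; simpa using saddleOp_sub D p q σ 0 0
    rw [hU0, sub_zero] at UE
    have UE' := congrArg V UE
    rw [h2, hVX2, hVa] at UE'
    have h4 : V (C (ω - p * q) * U 1) = V (C ω * U 1) - V (C (p * q) * U 1) := by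
      rw [map_sub, sub_mul, hVs]
    rw [h4] at VE
    have e1 := V1 (U (C q * 1))
    have e2 := V1 (U 1)
    have h5 : coeffDerivation D (C q * a) = C (D q) * a + C q * coeffDerivation D a := by
      rw [Derivation.leibniz, coeffDerivation_C, smul_eq_mul, smul_eq_mul]; ring
    rw [hmul (C q * 1), mul_one, h5] at e1
    have hvC : C v * C (D q) = (1 : ℂ⟦X⟧⟦X⟧) := by rw [← map_mul, hv, map_one]
    simp only [mul_one, map_neg, map_sub, map_mul] at UE' VE e1 e2
    simp only [← ha] at UE' VE e1 e2
    have hfin : X ^ 2 * (X * d⁄dX ℂ⟦X⟧ a) = 0 := by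
      linear_combination -UE' - VE + 2 * e1 - 2 * C q * e2 + 2 * X ^ 2 * a * hvC
    exact (mul_eq_zero.mp hfin).resolve_left (pow_ne_zero 2 X_ne_zero)
  have hda : d⁄dX ℂ⟦X⟧ a = 0 := (mul_eq_zero.mp hN).resolve_left X_ne_zero
  have hac : a = C (coeff 0 a) := eq_of_derivative_eq (by rw [hda, derivative_C]) (by simp)
  rw [hmul, hac, ha, hV, hU, coeff_zero_saddleOp, coeff_zero_saddleOp]
  congr 2
  simp
  ring

end Inversion

/-! ### From the saddle point expansion to the algebraic functional. -/

section SaddleExpansion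

/-- The formal Gaussian integral of polynomials as an additive map. -/
noncomputable def polyIntegralHom (s : ℂ) : ℂ[X] →+ ℂ where
  toFun := polyIntegral s
  map_zero' := by simp [polyIntegral]
  map_add' P Q := Polynomial.sum_add_index P Q _ (by simp) (by intros; ring)

lemma polyIntegral_C_mul_X_pow (s a : ℂ) (k : ℕ) :
    polyIntegral s (Polynomial.C a * Polynomial.X ^ k) = a * moment s k := by
  rw [polyIntegral, Polynomial.C_mul_X_pow_eq_monomial, Polynomial.sum_monomial_index _ _ (by simp)]

/-- The substitution `t = √ħ ξ`. -/
noncomputable def dilate : ℂ⟦X⟧ →+* ℂ[X]⟦X⟧ :=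
  (rescale Polynomial.X).comp (PowerSeries.map Polynomial.C)

lemma coeff_dilate (G : ℂ⟦X⟧) (n : ℕ) :
    coeff n (dilate G) = Polynomial.C (coeff n G) * Polynomial.X ^ n := by
  rw [dilate, RingHom.comp_apply, coeff_rescale, coeff_map, mul_comm]

/-- The Taylor series at `z` of a function of a complex variable. -/
noncomputable def taylorAt (z : ℂ) (f : ℂ → ℂ) : ℂ⟦X⟧ :=
  PowerSeries.mk fun n => iteratedDeriv n f z / (n ! : ℂ)

/-- The terms of order at least three of the Taylor series of `S` at `z`, divided by `t²`. -/
noncomputable def cubicTerms (S : ℂ → ℂ) (z : ℂ) : ℂ⟦X⟧ :=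
  PowerSeries.mk fun m => if m = 0 then 0 else coeff (m + 2) (taylorAt z S)

lemma coeff_zero_cubicTerms (S : ℂ → ℂ) (z : ℂ) : coeff 0 (cubicTerms S z) = 0 := by
  rw [cubicTerms, coeff_mk, if_pos rfl]

lemma higherTerms_eq (S : ℂ → ℂ) (z : ℂ) :
    higherTerms S z = C (Polynomial.X ^ 2) * dilate (cubicTerms S z) := by
  ext1 m
  rw [coeff_C_mul, coeff_dilate, higherTerms, cubicTerms, coeff_mk, coeff_mk]
  split_ifs
  · simp
  · rw [taylorAt, coeff_mk]
    ring

lemma coeff_exp_subst {H : ℂ[X]⟦X⟧} (hH : coeff 0 H = 0) {n N : ℕ} (hN : n < N) :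
    coeff n ((PowerSeries.exp ℂ[X]).subst H) =
      coeff n (∑ d ∈ range N, C (Polynomial.C (invFactorial ℂ d)) * H ^ d) := by
  have hX : (X : ℂ[X]⟦X⟧) ∣ H := X_dvd_iff.mpr (by simpa using hH)
  rw [coeff_subst' (HasSubst.of_constantCoeff_zero' (by simpa using hH)), map_sum,
    finsum_eq_sum_of_support_subset (s := range N)]
  · refine sum_congr rfl fun d _ => ?_
    rw [coeff_C_mul, coeff_exp, smul_eq_mul]
    congr 1
    rw [IsScalarTower.algebraMap_apply ℚ ℂ ℂ[X], Polynomial.algebraMap_apply, invFactorial]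
    simp
  · intro d hd
    by_contra h
    refine hd ?_
    have hlt : n < d := lt_of_lt_of_le hN (by simpa using h)
    simp only [X_pow_dvd_iff.mp (pow_dvd_pow_of_dvd hX d) n hlt, smul_zero]

lemma coeff_sum_mul (A : ℕ → ℂ[X]⟦X⟧) (Ψ : ℂ[X]⟦X⟧) (n : ℕ) :
    coeff n ((PowerSeries.mk fun n => ∑ p ∈ antidiagonal n, coeff p.1 (A p.2)) * Ψ) =
      ∑ p ∈ antidiagonal n, coeff p.1 (A p.2 * Ψ) := by
  induction n generalizing A with
  | zero => simp [coeff_mul]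
  | succ n ih =>
    have h : (PowerSeries.mk fun n => ∑ p ∈ antidiagonal n, coeff p.1 (A p.2)) =
        A 0 + X * PowerSeries.mk fun n => ∑ p ∈ antidiagonal n, coeff p.1 (A (p.2 + 1)) := by
      ext1 m
      cases m with
      | zero => simp
      | succ m => simp [coeff_succ_X_mul, Nat.sum_antidiagonal_succ']
    rw [h, add_mul, map_add, mul_assoc, coeff_succ_X_mul, ih fun m => A (m + 1),
      Nat.sum_antidiagonal_succ']

/-- Expanding the exponential, its d-th term carries ξ^{2d} times the d-th power of the cubic terms
evaluated at √ħ ξ. Hence order p in √ħ meets the moment of degree p + 2d. -/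
lemma coeff_saddleExpansion (S : ℂ → ℂ) (g : ℕ → ℂ → ℂ) (z s : ℂ) (n : ℕ) :
    coeff n (saddleExpansion S g z s) = ∑ p ∈ antidiagonal n,
      gaussFunctional s⁻¹ (cubicTerms S z) p.1 (taylorAt z (g p.2)) := by
  have hshift : shift g z = PowerSeries.mk fun n => ∑ p ∈ antidiagonal n,
      coeff p.1 (dilate (taylorAt z (g p.2))) := by
    ext1 n
    rw [shift, coeff_mk, coeff_mk]
    refine sum_congr rfl fun p _ => ?_
    rw [coeff_dilate, taylorAt, coeff_mk]
  have hH : coeff 0 (higherTerms S z) = 0 := by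
    rw [higherTerms, coeff_mk, if_pos rfl]
  have hprod : coeff n (shift g z * (PowerSeries.exp ℂ[X]).subst (higherTerms S z)) =
      coeff n (shift g z *
        ∑ d ∈ range (n + 1), C (Polynomial.C (invFactorial ℂ d)) * higherTerms S z ^ d) := by
    rw [coeff_mul, coeff_mul]
    refine sum_congr rfl fun p hp => ?_
    rw [coeff_exp_subst hH (N := n + 1) (Nat.antidiagonal.snd_lt hp)]
  rw [saddleExpansion, integral, coeff_mk, hprod, hshift,
    coeff_sum_mul fun m => dilate (taylorAt z (g m))]
  change polyIntegralHom s _ = _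
  rw [map_sum]
  refine sum_congr rfl fun p hp => ?_
  rw [gaussFunctional_apply_of_le _ (coeff_zero_cubicTerms S z) (Nat.antidiagonal.fst_lt hp),
    mul_sum, map_sum, map_sum]
  refine sum_congr rfl fun d _ => ?_
  have h : dilate (taylorAt z (g p.2)) *
      (C (Polynomial.C (invFactorial ℂ d)) * higherTerms S z ^ d) =
      C (Polynomial.C (invFactorial ℂ d) * Polynomial.X ^ (2 * d)) *
        dilate (taylorAt z (g p.2) * cubicTerms S z ^ d) := by
    rw [higherTerms_eq, map_mul dilate, map_pow dilate, map_mul C, mul_pow, ← map_pow C, ← pow_mul]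
    ring
  rw [h, coeff_C_mul, coeff_dilate, gaussMoment_inv]
  have h2 : Polynomial.C (invFactorial ℂ d) * Polynomial.X ^ (2 * d) *
      (Polynomial.C (coeff p.1 (taylorAt z (g p.2) * cubicTerms S z ^ d)) *
        Polynomial.X ^ p.1) = Polynomial.C (invFactorial ℂ d *
          coeff p.1 (taylorAt z (g p.2) * cubicTerms S z ^ d)) *
            Polynomial.X ^ (p.1 + 2 * d) := by
    rw [Polynomial.C_mul, pow_add]
    ring
  rw [h2]
  refine (polyIntegral_C_mul_X_pow _ _ _).trans ?_
  ring

end SaddleExpansion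

/-! ### Taylor series of germs with a moving base point. -/

section TaylorAt

variable {z : ℂ} {f g : ℂ → ℂ}

lemma coeff_taylorAt (z : ℂ) (f : ℂ → ℂ) (n : ℕ) :
    coeff n (taylorAt z f) = iteratedDeriv n f z / (n ! : ℂ) := coeff_mk _ _

lemma coeff_zero_taylorAt (z : ℂ) (f : ℂ → ℂ) : coeff 0 (taylorAt z f) = f z := by
  simp [coeff_taylorAt]

lemma derivative_taylorAt (z : ℂ) (f : ℂ → ℂ) :
    d⁄dX ℂ (taylorAt z f) = taylorAt z (deriv f) := by
  ext n
  rw [coeff_derivative, coeff_taylorAt, coeff_taylorAt, iteratedDeriv_succ', Nat.factorial_succ]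
  have : ((n : ℂ) + 1) ≠ 0 := by exact_mod_cast Nat.succ_ne_zero n
  push_cast
  field_simp

lemma taylorAt_congr (h : f =ᶠ[𝓝 z] g) : taylorAt z f = taylorAt z g := by
  ext n
  rw [coeff_taylorAt, coeff_taylorAt, h.iteratedDeriv_eq]

lemma taylorAt_const (z a : ℂ) : taylorAt z (fun _ => a) = C a := by
  ext n
  rw [coeff_taylorAt, iteratedDeriv_const, coeff_C]
  split_ifs with h
  · simp [h]
  · simp

lemma taylorAt_add (hf : AnalyticAt ℂ f z) (hg : AnalyticAt ℂ g z) :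
    taylorAt z (fun w => f w + g w) = taylorAt z f + taylorAt z g := by
  ext n
  induction n generalizing f g with
  | zero => simp only [map_add, coeff_zero_taylorAt]
  | succ n ih =>
    have h : coeff n (d⁄dX ℂ (taylorAt z fun w => f w + g w)) =
        coeff n (d⁄dX ℂ (taylorAt z f + taylorAt z g)) := by
      rw [map_add, derivative_taylorAt, derivative_taylorAt, derivative_taylorAt,
        ← ih hf.deriv hg.deriv]
      refine congrArg _ (taylorAt_congr ?_)
      filter_upwards [hf.eventually_analyticAt, hg.eventually_analyticAt] with w h1 h2
      exact deriv_fun_add h1.differentiableAt h2.differentiableAt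
    rw [coeff_derivative, coeff_derivative, mul_comm, mul_comm (coeff _ _)] at h
    exact natSucc_mul_cancel n h

lemma taylorAt_mul (hf : AnalyticAt ℂ f z) (hg : AnalyticAt ℂ g z) :
    taylorAt z (fun w => f w * g w) = taylorAt z f * taylorAt z g := by
  ext n
  induction n generalizing f g with
  | zero => simp only [coeff_mul, Nat.antidiagonal_zero, sum_singleton, coeff_zero_taylorAt]
  | succ n ih =>
    have h : coeff n (d⁄dX ℂ (taylorAt z fun w => f w * g w)) =
        coeff n (d⁄dX ℂ (taylorAt z f * taylorAt z g)) := by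
      rw [Derivation.leibniz, smul_eq_mul, smul_eq_mul, derivative_taylorAt, derivative_taylorAt,
        derivative_taylorAt, map_add, ← ih hf hg.deriv, ← ih hg hf.deriv, ← map_add,
        ← taylorAt_add (f := fun w => f w * deriv g w) (g := fun w => g w * deriv f w)
          (hf.mul hg.deriv) (hg.mul hf.deriv)]
      refine congrArg _ (taylorAt_congr ?_)
      filter_upwards [hf.eventually_analyticAt, hg.eventually_analyticAt] with w h1 h2
      rw [deriv_fun_mul h1.differentiableAt h2.differentiableAt]
      ring
    rw [coeff_derivative, coeff_derivative, mul_comm, mul_comm (coeff _ _)] at h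
    exact natSucc_mul_cancel n h

/-- An analytic germ is the sum of its Taylor series; this converts formal identities into
equalities near z. -/
lemma eventuallyEq_of_taylorAt_eq (hf : AnalyticAt ℂ f z) (hg : AnalyticAt ℂ g z)
    (h : taylorAt z f = taylorAt z g) : f =ᶠ[𝓝 z] g := by
  have h1 := hf.hasFPowerSeriesAt
  have h2 := hg.hasFPowerSeriesAt
  have h3 : (fun n => iteratedDeriv n f z / (n ! : ℂ)) =
      fun n => iteratedDeriv n g z / (n ! : ℂ) := by
    funext n
    rw [← coeff_taylorAt, h, coeff_taylorAt]
  rw [h3] at h1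
  have h4 := h1.sub h2
  rw [sub_self] at h4
  filter_upwards [h4.eventually_eq_zero] with w hw
  exact sub_eq_zero.mp hw

/-- `f` is holomorphic at `z` with Taylor series `F`. -/
def HasTaylorAt (f : ℂ → ℂ) (F : ℂ⟦X⟧) (z : ℂ) : Prop :=
  AnalyticAt ℂ f z ∧ taylorAt z f = F

lemma _root_.AnalyticAt.hasTaylorAt (hf : AnalyticAt ℂ f z) : HasTaylorAt f (taylorAt z f) z :=
  ⟨hf, rfl⟩

namespace HasTaylorAt

variable {F G : ℂ⟦X⟧}

lemma congr (hf : HasTaylorAt f F z) (h : g =ᶠ[𝓝 z] f) : HasTaylorAt g F z :=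
  ⟨hf.1.congr h.symm, (taylorAt_congr h).trans hf.2⟩

lemma eventuallyEq (hf : HasTaylorAt f F z) (hg : HasTaylorAt g F z) : f =ᶠ[𝓝 z] g :=
  eventuallyEq_of_taylorAt_eq hf.1 hg.1 (hf.2.trans hg.2.symm)

lemma const (z a : ℂ) : HasTaylorAt (fun _ => a) (C a) z :=
  ⟨analyticAt_const, taylorAt_const z a⟩

lemma add (hf : HasTaylorAt f F z) (hg : HasTaylorAt g G z) :
    HasTaylorAt (fun w => f w + g w) (F + G) z :=
  ⟨hf.1.add hg.1, by rw [taylorAt_add hf.1 hg.1, hf.2, hg.2]⟩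

lemma mul (hf : HasTaylorAt f F z) (hg : HasTaylorAt g G z) :
    HasTaylorAt (fun w => f w * g w) (F * G) z :=
  ⟨hf.1.mul hg.1, by rw [taylorAt_mul hf.1 hg.1, hf.2, hg.2]⟩

lemma const_mul (a : ℂ) (hf : HasTaylorAt f F z) : HasTaylorAt (fun w => a * f w) (C a * F) z :=
  (const z a).mul hf

lemma sub (hf : HasTaylorAt f F z) (hg : HasTaylorAt g G z) :
    HasTaylorAt (fun w => f w - g w) (F - G) z := by
  have h := hf.add (hg.const_mul (-1))
  rw [map_neg, map_one, neg_one_mul, ← sub_eq_add_neg] at h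
  exact h.congr (Filter.Eventually.of_forall fun w => by ring)

lemma pow (hf : HasTaylorAt f F z) (n : ℕ) : HasTaylorAt (fun w => f w ^ n) (F ^ n) z := by
  induction n with
  | zero => simpa using const z 1
  | succ n ih => simpa only [pow_succ] using ih.mul hf

lemma deriv (hf : HasTaylorAt f F z) : HasTaylorAt (deriv f) (d⁄dX ℂ F) z :=
  ⟨hf.1.deriv, by rw [← derivative_taylorAt, hf.2]⟩

lemma iteratedDeriv (hf : HasTaylorAt f F z) (n : ℕ) :
    HasTaylorAt (iteratedDeriv n f) ((d⁄dX ℂ)^[n] F) z := by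
  induction n generalizing f F with
  | zero => simpa using hf
  | succ n ih =>
    rw [iteratedDeriv_succ', Function.iterate_succ_apply]
    exact ih hf.deriv

lemma sum {ι : Type*} {s : Finset ι} {f : ι → ℂ → ℂ} {F : ι → ℂ⟦X⟧}
    (h : ∀ i ∈ s, HasTaylorAt (f i) (F i) z) :
    HasTaylorAt (fun w => ∑ i ∈ s, f i w) (∑ i ∈ s, F i) z := by
  classical
  induction s using Finset.induction_on with
  | empty => simpa using const z 0
  | insert i s hi ih =>
    simp only [sum_insert hi]
    exact (h i (mem_insert_self i s)).add (ih fun j hj => h j (mem_insert_of_mem hj))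

end HasTaylorAt

/-- The coefficients of the family of power series `P` have as Taylor series at `z` the
coefficients of `Q`. -/
def HasTaylorFamilyAt (P : ℂ → ℂ⟦X⟧) (Q : ℂ⟦X⟧⟦X⟧) (z : ℂ) : Prop :=
  ∀ k, HasTaylorAt (fun w => coeff k (P w)) (coeff k Q) z

namespace HasTaylorFamilyAt

variable {P P' : ℂ → ℂ⟦X⟧} {Q Q' : ℂ⟦X⟧⟦X⟧}

lemma mul (h : HasTaylorFamilyAt P Q z) (h' : HasTaylorFamilyAt P' Q' z) :
    HasTaylorFamilyAt (fun w => P w * P' w) (Q * Q') z := by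
  intro k
  simp only [coeff_mul]
  exact HasTaylorAt.sum fun p _ => (h p.1).mul (h' p.2)

lemma C_const {f : ℂ → ℂ} {F : ℂ⟦X⟧} (h : HasTaylorAt f F z) :
    HasTaylorFamilyAt (fun w => C (f w)) (C F) z := by
  intro k
  simp only [coeff_C]
  split_ifs
  · exact h
  · simpa using HasTaylorAt.const z 0

lemma sub (h : HasTaylorFamilyAt P Q z) (h' : HasTaylorFamilyAt P' Q' z) :
    HasTaylorFamilyAt (fun w => P w - P' w) (Q - Q') z := by
  intro k
  simp only [map_sub]
  exact (h k).sub (h' k)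

lemma pow (h : HasTaylorFamilyAt P Q z) (n : ℕ) :
    HasTaylorFamilyAt (fun w => P w ^ n) (Q ^ n) z := by
  induction n with
  | zero => simpa using C_const (HasTaylorAt.const z 1)
  | succ n ih => simpa only [pow_succ] using ih.mul h

lemma congr (h : HasTaylorFamilyAt P Q z) (h' : P' =ᶠ[𝓝 z] P) : HasTaylorFamilyAt P' Q z :=
  fun k => (h k).congr (h'.mono fun w hw => by simp only [hw])

/-- This links the two levels of expansion: the k-th coefficient at a moving point w is
f^{(k)}(w)/k!, itself a germ in w with Taylor series D^k F/k!. -/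
lemma taylorAt {f : ℂ → ℂ} {F : ℂ⟦X⟧} (hf : HasTaylorAt f F z) :
    HasTaylorFamilyAt (fun w => taylorAt w f) (taylor (d⁄dX ℂ) F) z := by
  intro k
  have h := (hf.iteratedDeriv k).const_mul (k ! : ℂ)⁻¹
  simp only [coeff_taylor, coeff_taylorAt]
  exact h.congr (Filter.Eventually.of_forall fun w => div_eq_inv_mul _ _)

end HasTaylorFamilyAt

lemma HasTaylorAt.gaussMoment {f : ℂ → ℂ} {F : ℂ⟦X⟧} (hf : HasTaylorAt f F z) (k : ℕ) :
    HasTaylorAt (fun w => gaussMoment (f w) k) (gaussMoment F k) z := by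
  unfold FormalGauss.gaussMoment
  split_ifs
  · have h := (hf.pow (k + 1)).const_mul ((k - 1)‼ : ℂ)
    rwa [map_natCast] at h
  · simpa using HasTaylorAt.const z 0

lemma HasTaylorFamilyAt.gaussFunctional {f : ℂ → ℂ} {F : ℂ⟦X⟧} {P E : ℂ → ℂ⟦X⟧}
    {Q E' : ℂ⟦X⟧⟦X⟧} (hf : HasTaylorAt f F z) (hE : HasTaylorFamilyAt E E' z)
    (hP : HasTaylorFamilyAt P Q z) (k : ℕ) :
    HasTaylorAt (fun w => gaussFunctional (f w) (E w) k (P w)) (gaussFunctional F E' k Q) z := by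
  simp only [gaussFunctional_apply]
  refine HasTaylorAt.sum fun j _ => ((hf.gaussMoment _).mul ?_).mul (hP.mul (hE.pow j) k)
  exact HasTaylorAt.const z _

end TaylorAt

/-! ### The analytic phase and its Taylor coefficients. -/

section Phase

open Metric

/-- On a ball p q' has a holomorphic primitive H, so the segment integral is H(χ) - H(z) and
differentiates to p q'. -/
lemma deriv_phase_eventuallyEq {p q : ℂ → ℂ} {z : ℂ} (hp : AnalyticAt ℂ p z)
    (hq : AnalyticAt ℂ q z) :
    deriv (phase p q z) =ᶠ[𝓝 z] fun w => (p w - p z) * deriv q w := by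
  obtain ⟨ε, hε, hball⟩ := Metric.eventually_nhds_iff_ball.mp
    (hp.eventually_analyticAt.and hq.eventually_analyticAt)
  have hdiff : DifferentiableOn ℂ (fun w => p w * deriv q w) (ball z ε) := fun w hw =>
    ((hball w hw).1.mul (hball w hw).2.deriv).differentiableAt.differentiableWithinAt
  obtain ⟨H, hH⟩ := hdiff.isExactOn_ball
  have hmem : ∀ w ∈ ball z ε, ∀ t ∈ Set.uIcc (0 : ℝ) 1, z + t * (w - z) ∈ ball z ε := by
    intro w hw t ht
    rw [Set.uIcc_of_le zero_le_one] at ht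
    rw [mem_ball_iff_norm] at hw ⊢
    rw [add_sub_cancel_left, norm_mul, Complex.norm_real, Real.norm_of_nonneg ht.1]
    exact lt_of_le_of_lt (mul_le_of_le_one_left (norm_nonneg _) ht.2) hw
  have hint : ∀ w ∈ ball z ε, phase p q z w = p z * (q z - q w) + (H w - H z) := by
    intro w hw
    have hd : ∀ t ∈ Set.uIcc (0 : ℝ) 1, HasDerivAt (fun t : ℝ => H (z + t * (w - z)))
        (p (z + t * (w - z)) * deriv q (z + t * (w - z)) * (w - z)) t := by
      intro t ht
      have h1 : HasDerivAt (fun t : ℝ => z + (t : ℂ) * (w - z)) (w - z) t := by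
        simpa using ((Complex.ofRealCLM.hasDerivAt (x := t)).mul_const (w - z)).const_add z
      exact (hH _ (hmem w hw t ht)).comp t h1
    have hcont : ContinuousOn (fun t : ℝ =>
        p (z + t * (w - z)) * deriv q (z + t * (w - z)) * (w - z)) (Set.uIcc 0 1) := by
      refine ContinuousOn.mul (hdiff.continuousOn.comp (by fun_prop) (hmem w hw))
        continuousOn_const
    rw [phase, intervalIntegral.integral_eq_sub_of_hasDerivAt hd hcont.intervalIntegrable]
    simp
  filter_upwards [ball_mem_nhds z hε] with w hw
  have hev : phase p q z =ᶠ[𝓝 w] fun w => p z * (q z - q w) + (H w - H z) := by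
    filter_upwards [isOpen_ball.mem_nhds hw] with v hv using hint v hv
  have hq' := (hball w hw).2.differentiableAt.hasDerivAt
  have hd : HasDerivAt (fun w => p z * (q z - q w) + (H w - H z))
      (p z * -deriv q w + p w * deriv q w) w :=
    ((hq'.const_sub (q z)).const_mul (p z)).add ((hH w hw).sub_const (H z))
  rw [hev.deriv_eq, hd.deriv]
  ring

lemma cubicTerms_phase {p q : ℂ → ℂ} {z : ℂ} (hp : AnalyticAt ℂ p z) (hq : AnalyticAt ℂ q z) :
    cubicTerms (phase p q z) z = PowerSeries.mk fun m => if m = 0 then 0 else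
      (m + 2 : ℂ)⁻¹ * coeff (m + 1)
        ((taylorAt z p - C (p z)) * taylorAt z (deriv q)) := by
  ext m
  rw [cubicTerms, coeff_mk, coeff_mk]
  split_ifs with hm
  · rfl
  have h1 : taylorAt z (fun w => (p w - p z) * deriv q w) =
      (taylorAt z p - C (p z)) * taylorAt z (deriv q) :=
    ((hp.hasTaylorAt.sub (HasTaylorAt.const z (p z))).mul hq.deriv.hasTaylorAt).2
  have h := congrArg (coeff (m + 1)) (derivative_taylorAt z (phase p q z))
  rw [taylorAt_congr (deriv_phase_eventuallyEq hp hq), h1, coeff_derivative] at h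
  have h2 : (m + 2 : ℂ) ≠ 0 := by exact_mod_cast (show m + 2 ≠ 0 by omega)
  rw [← h]
  push_cast
  field_simp
  ring

lemma hasTaylorFamilyAt_cubicTerms_phase {p q : ℂ → ℂ} {z : ℂ} (hp : AnalyticAt ℂ p z)
    (hq : AnalyticAt ℂ q z) :
    HasTaylorFamilyAt (fun w => cubicTerms (phase p q w) w)
      (phaseTerms (d⁄dX ℂ) (taylorAt z p) (taylorAt z q)) z := by
  have h : HasTaylorFamilyAt (fun w => PowerSeries.mk fun m => if m = 0 then 0 else
      (m + 2 : ℂ)⁻¹ * coeff (m + 1) ((taylorAt w p - C (p w)) * taylorAt w (deriv q)))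
      (phaseTerms (d⁄dX ℂ) (taylorAt z p) (taylorAt z q)) z := by
    intro m
    simp only [phaseTerms, coeff_mk]
    split_ifs
    · simpa using HasTaylorAt.const z 0
    · exact (((HasTaylorFamilyAt.taylorAt hp.hasTaylorAt).sub
        (HasTaylorFamilyAt.C_const hp.hasTaylorAt)).mul
        (HasTaylorFamilyAt.taylorAt hq.hasTaylorAt.deriv) (m + 1)).const_mul _
  refine h.congr ?_
  filter_upwards [hp.eventually_analyticAt, hq.eventually_analyticAt] with w h1 h2
  exact cubicTerms_phase h1 h2

lemma hasTaylorAt_coeff_saddleExpansion {p q s : ℂ → ℂ} {z : ℂ} (hp : AnalyticAt ℂ p z)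
    (hq : AnalyticAt ℂ q z) (hs : AnalyticAt ℂ (fun w => (s w)⁻¹) z) {g : ℕ → ℂ → ℂ}
    {G : ℂ⟦X⟧⟦X⟧} (hg : ∀ n, HasTaylorAt (g n) (coeff n G) z) (n : ℕ) :
    HasTaylorAt (fun w => coeff n
        (saddleExpansion (phase p q w) (fun m χ => g m χ * deriv q χ) w (s w)))
      (coeff n (saddleOp (d⁄dX ℂ) (taylorAt z p) (taylorAt z q)
        (taylorAt z fun w => (s w)⁻¹) G)) z := by
  simp only [coeff_saddleExpansion, saddleOp, coeff_convolve]
  exact HasTaylorAt.sum fun m _ => HasTaylorFamilyAt.gaussFunctional hs.hasTaylorAt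
    (hasTaylorFamilyAt_cubicTerms_phase hp hq)
    (HasTaylorFamilyAt.taylorAt ((hg m.2).mul hq.hasTaylorAt.deriv)) m.1

lemma phase_neg_left (p q : ℂ → ℂ) (z : ℂ) :
    phase (-p) q z = fun χ => -phase p q z χ := by
  funext χ
  simp only [phase, Pi.neg_apply, neg_mul, intervalIntegral.integral_neg]
  ring

end Phase

/-- The phase is bilinear in (p, q), so both signs cancel there; only the amplitude factor q'
changes sign. -/
lemma saddleOp_neg_neg {R : Type*} [CommRing R] [Algebra ℂ R] (D : Derivation ℂ R R)
    (p q σ : R) (F : R⟦X⟧) : saddleOp D (-p) (-q) σ F = -saddleOp D p q σ F := by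
  have h : phaseTerms D (-p) (-q) = phaseTerms D p q := by
    have : (taylor D (-p) - C (-p)) * taylor D (D (-q)) =
        (taylor D p - C p) * taylor D (D q) := by
      simp only [map_neg]
      ring
    rw [phaseTerms, this, phaseTerms]
  ext n
  simp [saddleOp, coeff_convolve, saddleCoeff, h]

/-- Odd Gaussian moments vanish, so the operator has only even orders in √ħ and preserves parity. -/
lemma coeff_saddleOp_of_odd {R : Type*} [CommRing R] [Algebra ℂ R] (D : Derivation ℂ R R)
    (p q σ : R) {F : R⟦X⟧} (hF : ∀ n, Odd n → coeff n F = 0) {n : ℕ} (hn : Odd n) :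
    coeff n (saddleOp D p q σ F) = 0 := by
  rw [saddleOp, coeff_convolve]
  refine sum_eq_zero fun m hm => ?_
  rcases Nat.even_or_odd m.1 with h | h
  · rw [hF m.2, saddleCoeff_zero_right]
    rw [← mem_antidiagonal.mp hm, Nat.odd_add] at hn
    exact Nat.not_even_iff_odd.mp fun h' => Nat.not_even_iff_odd.mpr (hn.mpr h') h
  · exact saddleCoeff_of_odd D p q σ h _

/-! ### The two transforms as saddle point operators. -/

section Transforms

variable {x y r : ℂ → ℂ} {z₀ : ℂ}

/-- The series in `√ħ` of the Taylor series at `z` of the coefficients of `f`. -/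
noncomputable def taylorSeq (z : ℂ) (f : ℕ → ℂ → ℂ) : ℂ⟦X⟧⟦X⟧ :=
  PowerSeries.mk fun n => taylorAt z (f n)

lemma hasTaylorAt_taylorSeq {f : ℕ → ℂ → ℂ} (hf : ∀ n, AnalyticAt ℂ (f n) z₀) (n : ℕ) :
    HasTaylorAt (f n) (coeff n (taylorSeq z₀ f)) z₀ := by
  rw [taylorSeq, coeff_mk]
  exact (hf n).hasTaylorAt

lemma hasTaylorAt_ofDual (hx : AnalyticAt ℂ x z₀) (hy : AnalyticAt ℂ y z₀)
    (hr : AnalyticAt ℂ r z₀) (hr0 : r z₀ ≠ 0) {f : ℕ → ℂ → ℂ} {F : ℂ⟦X⟧⟦X⟧}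
    (hf : ∀ n, HasTaylorAt (f n) (coeff n F) z₀) (n : ℕ) :
    HasTaylorAt (ofDual x y r f n) (coeff n (C (C Complex.I) *
      saddleOp (d⁄dX ℂ) (taylorAt z₀ x) (taylorAt z₀ y)
        (C (-Complex.I) * taylorAt z₀ fun w => (r w)⁻¹) F)) z₀ := by
  have hinv : AnalyticAt ℂ (fun w => (Complex.I * r w)⁻¹) z₀ :=
    (analyticAt_const.mul hr).inv (mul_ne_zero Complex.I_ne_zero hr0)
  have h := (hasTaylorAt_coeff_saddleExpansion hx hy hinv hf n).const_mul Complex.I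
  have hσ : (taylorAt z₀ fun w => (Complex.I * r w)⁻¹) =
      C (-Complex.I) * taylorAt z₀ fun w => (r w)⁻¹ := by
    have h1 : HasTaylorAt (fun w => (r w)⁻¹) (taylorAt z₀ fun w => (r w)⁻¹) z₀ :=
      (hr.inv hr0).hasTaylorAt
    rw [← (h1.const_mul (-Complex.I)).2]
    refine congrArg _ (funext fun w => ?_)
    rw [mul_inv, Complex.inv_I]
  rw [hσ] at h
  rw [coeff_C_mul]
  exact h

lemma hasTaylorAt_toDual (hx : AnalyticAt ℂ x z₀) (hy : AnalyticAt ℂ y z₀)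
    (hr : AnalyticAt ℂ r z₀) (hr0 : r z₀ ≠ 0) {f : ℕ → ℂ → ℂ} {F : ℂ⟦X⟧⟦X⟧}
    (hf : ∀ n, HasTaylorAt (f n) (coeff n F) z₀) (n : ℕ) :
    HasTaylorAt (toDual x y r f n) (coeff n
      (saddleOp (d⁄dX ℂ) (-taylorAt z₀ y) (taylorAt z₀ x) (taylorAt z₀ fun w => (r w)⁻¹) F))
      z₀ := by
  have h := hasTaylorAt_coeff_saddleExpansion hy.neg hx (hr.inv hr0) hf n
  have hneg : taylorAt z₀ (-y) = -taylorAt z₀ y := by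
    have h1 := (hy.hasTaylorAt.const_mul (-1)).2
    rw [map_neg, map_one, neg_one_mul] at h1
    rw [← h1]
    refine congrArg _ (funext fun w => ?_)
    simp
  rw [hneg] at h
  simp only [phase_neg_left] at h
  exact h

lemma taylorAt_inv_sq_mul (hx : AnalyticAt ℂ x z₀) (hy : AnalyticAt ℂ y z₀)
    (hr : AnalyticAt ℂ r z₀) (hr0 : r z₀ ≠ 0)
    (hr2 : ∀ᶠ z in 𝓝 z₀, r z ^ 2 = deriv x z * deriv y z) :
    (taylorAt z₀ fun w => (r w)⁻¹) ^ 2 *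
      (d⁄dX ℂ (taylorAt z₀ x) * d⁄dX ℂ (taylorAt z₀ y)) = 1 := by
  have h := (((hr.inv hr0).hasTaylorAt.pow 2).mul
    (hx.hasTaylorAt.deriv.mul hy.hasTaylorAt.deriv)).2
  refine h.symm.trans ?_
  rw [← map_one C, ← taylorAt_const z₀ 1]
  refine taylorAt_congr ?_
  filter_upwards [hr2, hr.continuousAt.eventually_ne hr0] with w h1 h2
  rw [← h1, Pi.inv_apply, inv_pow, inv_mul_cancel₀ (pow_ne_zero 2 h2)]

lemma C_I_mul_C_neg_I : (C Complex.I * C (-Complex.I) : ℂ⟦X⟧) = 1 := by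
  rw [← map_mul, mul_neg, Complex.I_mul_I, neg_neg, map_one]

lemma C_neg_I_sq : (C (-Complex.I) ^ 2 : ℂ⟦X⟧) = -1 := by
  rw [← map_pow, neg_sq, Complex.I_sq, map_neg, map_one]

lemma toDual_ofDual (hx : AnalyticAt ℂ x z₀) (hy : AnalyticAt ℂ y z₀)
    (hr : AnalyticAt ℂ r z₀) (hr0 : r z₀ ≠ 0)
    (hr2 : ∀ᶠ z in 𝓝 z₀, r z ^ 2 = deriv x z * deriv y z) {f : ℕ → ℂ → ℂ}
    (hf : ∀ n, AnalyticAt ℂ (f n) z₀) (n : ℕ) :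
    toDual x y r (ofDual x y r f) n =ᶠ[𝓝 z₀] f n := by
  have hF := hasTaylorAt_taylorSeq hf
  have hsq := taylorAt_inv_sq_mul hx hy hr hr0 hr2
  have h := hasTaylorAt_toDual hx hy hr hr0 (hasTaylorAt_ofDual hx hy hr hr0 hF) n
  set ρ := taylorAt z₀ fun w => (r w)⁻¹
  have hsmul (G : ℂ⟦X⟧⟦X⟧) : C (C Complex.I) * G = Complex.I • G := by
    ext n m
    rw [coeff_C_mul, coeff_C_mul]
    rfl
  have hinv : saddleOp (d⁄dX ℂ) (-taylorAt z₀ y) (taylorAt z₀ x) ρ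
      (C (C Complex.I) * saddleOp (d⁄dX ℂ) (taylorAt z₀ x) (taylorAt z₀ y)
        (C (-Complex.I) * ρ) (taylorSeq z₀ f)) = taylorSeq z₀ f := by
    rw [hsmul, saddleOp_smul, ← hsmul, saddleOp_saddleOp _ hsq, mul_left_comm, ← map_mul]
    -- The constant is i · (1/i) · ρ²x'y' = 1: the prefactor of T undoes its branch s = ir.
    · have h1 : C Complex.I * (ρ * (C (-Complex.I) * ρ) *
          (d⁄dX ℂ (taylorAt z₀ x) * d⁄dX ℂ (taylorAt z₀ y))) = 1 := by
        linear_combination C_I_mul_C_neg_I * ρ ^ 2 *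
          (d⁄dX ℂ (taylorAt z₀ x) * d⁄dX ℂ (taylorAt z₀ y)) + hsq
      rw [h1, map_one, mul_one]
    · linear_combination ρ ^ 2 * (d⁄dX ℂ (taylorAt z₀ x) * d⁄dX ℂ (taylorAt z₀ y)) *
        C_neg_I_sq - hsq
  rw [hinv] at h
  exact h.eventuallyEq (hF n)

lemma ofDual_toDual (hx : AnalyticAt ℂ x z₀) (hy : AnalyticAt ℂ y z₀)
    (hr : AnalyticAt ℂ r z₀) (hr0 : r z₀ ≠ 0)
    (hr2 : ∀ᶠ z in 𝓝 z₀, r z ^ 2 = deriv x z * deriv y z) {f : ℕ → ℂ → ℂ}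
    (hf : ∀ n, AnalyticAt ℂ (f n) z₀) (n : ℕ) :
    ofDual x y r (toDual x y r f) n =ᶠ[𝓝 z₀] f n := by
  have hF := hasTaylorAt_taylorSeq hf
  have hsq := taylorAt_inv_sq_mul hx hy hr hr0 hr2
  have h := hasTaylorAt_ofDual hx hy hr hr0 (hasTaylorAt_toDual hx hy hr hr0 hF) n
  set ρ := taylorAt z₀ fun w => (r w)⁻¹
  have hinv : C (C Complex.I) * saddleOp (d⁄dX ℂ) (taylorAt z₀ x) (taylorAt z₀ y)
      (C (-Complex.I) * ρ) (saddleOp (d⁄dX ℂ) (-taylorAt z₀ y) (taylorAt z₀ x) ρ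
        (taylorSeq z₀ f)) = taylorSeq z₀ f := by
    have h1 : ρ ^ 2 * (d⁄dX ℂ (-taylorAt z₀ y) * d⁄dX ℂ (taylorAt z₀ x)) = -1 := by
      rw [map_neg]
      linear_combination -hsq
    have h2 : (C (-Complex.I) * ρ) ^ 2 *
        (d⁄dX ℂ (-taylorAt z₀ y) * d⁄dX ℂ (taylorAt z₀ x)) = 1 := by
      linear_combination C_neg_I_sq * ρ ^ 2 *
        (d⁄dX ℂ (-taylorAt z₀ y) * d⁄dX ℂ (taylorAt z₀ x)) - h1
    -- The inversion theorem for (-y, x) has outer pair (-x, -y), which differs by an overall sign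
    -- from the pair (x, y) in T.
    have h3 := saddleOp_saddleOp h1 h2 (taylorSeq z₀ f)
    rw [saddleOp_neg_neg, neg_eq_iff_eq_neg] at h3
    have h4 : C Complex.I * (C (-Complex.I) * ρ * ρ *
        (d⁄dX ℂ (-taylorAt z₀ y) * d⁄dX ℂ (taylorAt z₀ x))) = -1 := by
      linear_combination C_I_mul_C_neg_I * ρ ^ 2 *
        (d⁄dX ℂ (-taylorAt z₀ y) * d⁄dX ℂ (taylorAt z₀ x)) + h1
    rw [h3, mul_neg, mul_left_comm, ← map_mul, h4, map_neg, map_one]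
    ring
  rw [hinv] at h
  exact h.eventuallyEq (hF n)

lemma coeff_taylorSeq_of_odd {g : ℕ → ℂ → ℂ} (hg : ∀ n, Odd n → g n =ᶠ[𝓝 z₀] 0) (n : ℕ)
    (hn : Odd n) : coeff n (taylorSeq z₀ g) = 0 := by
  rw [taylorSeq, coeff_mk, taylorAt_congr (hg n hn)]
  exact (taylorAt_const z₀ 0).trans (map_zero C)

lemma HasTaylorAt.eventuallyEq_zero {f : ℂ → ℂ} (h : HasTaylorAt f 0 z₀) : f =ᶠ[𝓝 z₀] 0 :=
  h.eventuallyEq (map_zero (C (R := ℂ)) ▸ HasTaylorAt.const z₀ 0)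

end Transforms

end FormalGauss

theorem mainTheorem12 (x y r : ℂ → ℂ) (z₀ : ℂ)
    (hx : AnalyticAt ℂ x z₀) (hy : AnalyticAt ℂ y z₀)
    (hx' : deriv x z₀ ≠ 0) (hy' : deriv y z₀ ≠ 0)
    (hr : AnalyticAt ℂ r z₀) (hr2 : ∀ᶠ z in 𝓝 z₀, r z ^ 2 = deriv x z * deriv y z) :
    -- series in `√ħ` with holomorphic coefficients: the two transforms are mutually inverse
    (∀ fv : ℕ → ℂ → ℂ, (∀ n, AnalyticAt ℂ (fv n) z₀) →
      (∀ n, AnalyticAt ℂ (FormalGauss.ofDual x y r fv n) z₀) ∧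
      ∀ n, FormalGauss.toDual x y r (FormalGauss.ofDual x y r fv) n =ᶠ[𝓝 z₀] fv n) ∧
    (∀ f : ℕ → ℂ → ℂ, (∀ n, AnalyticAt ℂ (f n) z₀) →
      (∀ n, AnalyticAt ℂ (FormalGauss.toDual x y r f n) z₀) ∧
      ∀ n, FormalGauss.ofDual x y r (FormalGauss.toDual x y r f) n =ᶠ[𝓝 z₀] f n) ∧
    -- both transforms send series in `ħ` to series in `ħ`
    (∀ g : ℕ → ℂ → ℂ, (∀ n, AnalyticAt ℂ (g n) z₀) →
      (∀ n, Odd n → g n =ᶠ[𝓝 z₀] 0) →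
      (∀ n, Odd n → FormalGauss.ofDual x y r g n =ᶠ[𝓝 z₀] 0) ∧
      (∀ n, Odd n → FormalGauss.toDual x y r g n =ᶠ[𝓝 z₀] 0)) := by
  have hr0 : r z₀ ≠ 0 := fun h => mul_ne_zero hx' hy' (by rw [← hr2.self_of_nhds, h]; ring)
  refine ⟨fun fv hfv => ⟨fun n => ?_, ?_⟩, fun f hf => ⟨fun n => ?_, ?_⟩,
    fun g hg hodd => ⟨fun n hn => ?_, fun n hn => ?_⟩⟩
  · exact (FormalGauss.hasTaylorAt_ofDual hx hy hr hr0
      (FormalGauss.hasTaylorAt_taylorSeq hfv) n).1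
  · exact FormalGauss.toDual_ofDual hx hy hr hr0 hr2 hfv
  · exact (FormalGauss.hasTaylorAt_toDual hx hy hr hr0
      (FormalGauss.hasTaylorAt_taylorSeq hf) n).1
  · exact FormalGauss.ofDual_toDual hx hy hr hr0 hr2 hf
  · have h := FormalGauss.hasTaylorAt_ofDual hx hy hr hr0
      (FormalGauss.hasTaylorAt_taylorSeq hg) n
    rw [PowerSeries.coeff_C_mul, FormalGauss.coeff_saddleOp_of_odd _ _ _ _
      (FormalGauss.coeff_taylorSeq_of_odd hodd) hn, mul_zero] at h
    exact h.eventuallyEq_zero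
  · have h := FormalGauss.hasTaylorAt_toDual hx hy hr hr0
      (FormalGauss.hasTaylorAt_taylorSeq hg) n
    rw [FormalGauss.coeff_saddleOp_of_odd _ _ _ _
      (FormalGauss.coeff_taylorSeq_of_odd hodd) hn] at h
    exact h.eventuallyEq_zero
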